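/- Let $R>0$ and let $f\in\mathcal D'(\mathbb R^4)$ be a complex-valued distribution whose support is contained in the closed Euclidean ball of radius $R$ around $0$. Write $y=(y_0,\vec y)\in\mathbb R\times\mathbb R^3$, let $\hat f(k_0,\vec k)=\int f(y)\,e^{i(k_0y_0-\vec k\cdot\vec y)}\,dy$ be the Fourier transform of $f$ (a smooth function, namely $f$ applied to $\chi(y)\,e^{i(k_0y_0-\vec k\cdot\vec y)}$ for any $\chi\in C_c^\infty(\mathbb R^4)$ equal to $1$ near $\operatorname{supp} f$), and for $m\ge 0$ put $\omega_p=\sqrt{|\vec p|^2+m^2}$. For $\vec x\in\mathbb R^3$, complex $z$ and $b>0$ consider $$I_f(z,\vec x)=\int_{\mathbb R^3}\frac{d^3\vec p}{2\omega_p}\,e^{-i(z\omega_p-\vec p\cdot\vec x)}\,\hat f(\omega_p,\vec p),\qquad I_f^b(z,\vec x)=\int_{\mathbb R^3}\frac{d^3\vec p}{2\omega_p}\,e^{-i(z\omega_p-\vec p\cdot\vec x)}\,e^{-b\omega_p}\,\hat f(-\omega_p,\vec p).$$ For real $z=x_0$ the integral $I_f$ is understood as an oscillatory integral, that is, as the tempered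 distribution $\varphi\mapsto\int\frac{d^3\vec p}{2\omega_p}\hat f(\omega_p,\vec p)\int_{\mathbb R^4} e^{-i(\omega_py_0-\vec p\cdot\vec y)}\varphi(y)\,dy$ on $\mathcal S(\mathbb R^4)$. Let $\mathbb C_-=\{z:\operatorname{Im}z<0\}$. We call a function on $\mathbb C_-\times\mathbb R^3$ analytic if it is real analytic in $(z,\vec x)$ jointly and holomorphic in $z$ for every $\vec x$. (1) For every $m\ge0$, $I_f$ has an analytic continuation into $\mathbb C_-\times\mathbb R^3$: the integral defining $I_f(z,\vec x)$ converges absolutely for all $z\in\mathbb C_-$, $\vec x\in\mathbb R^3$, the function $I_f$ so defined is analytic on $\mathbb C_-\times\mathbb R^3$, and its boundary value at real times is the distribution above: for every $\varphi\in\mathcal S(\mathbb R^4)$ all the integrals in question converge absolutely and $$\lim_{\varepsilon\downarrow0}\int_{\mathbb R^4} I_f(y_0-i\varepsilon,\vec y)\,\varphi(y)\,dy=\int\frac{d^3\vec p}{2\omega_p}\hat f(\omega_p,\vec p)\int_{\mathbb R^4} e^{-i(\omega_py_0-\vec p\cdot\vec y)}\varphi(y)\,dy.$$ (2) For every $m\ge0$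 and $b>0$, $I_f^b$ has an analytic continuation into $\mathbb C_-\times\mathbb R^3$: the integral defining $I_f^b(z,\vec x)$ converges absolutely for all $z$ with $\operatorname{Im}z\le0$ and all $\vec x\in\mathbb R^3$, and $I_f^b$ is analytic on $\mathbb C_-\times\mathbb R^3$ and continuous on $\overline{\mathbb C_-}\times\mathbb R^3$. (3) For every $m>0$ there is a constant $c$ (depending only on $f$, $R$ and $m$) such that for all $u>0$ and $\vec x\in\mathbb R^3$ with $r=\sqrt{u^2+|\vec x|^2}\ge 2R$ $$|I_f(-iu,\vec x)|\le c\,e^{-mr}\qquad\text{and}\qquad |I_f^b(-iu,\vec x)|\le c\,e^{-mr}\quad\text{for all } b>0 .$$ -/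

import Mathlib

open Set Filter Topology MeasureTheory TopologicalSpace
open scoped Distributions SchwartzMap ContDiff Manifold

noncomputable section

/-- Spacetime `ℝ⁴` with its Euclidean norm; the coordinate `0` is time. -/
abbrev Spacetime := EuclideanSpace ℝ (Fin 4)

/-- The space `ℝ³` of positions and of momenta. -/
abbrev Space3 := EuclideanSpace ℝ (Fin 3)

/-- The spatial part `(y₁, y₂, y₃)` of a point `y = (y₀, y₁, y₂, y₃)` of spacetime. -/
def spatial (y : Spacetime) : Space3 := WithLp.toLp 2 fun i => y i.succ

/-- The Minkowski product `k₀ y₀ - k·y` of `(k₀, k)` and the spacetime point `y`. -/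
def minkowski (k₀ : ℝ) (k : Space3) (y : Spacetime) : ℝ := k₀ * y 0 - inner ℝ k (spatial y)

theorem contDiff_minkowski (k₀ : ℝ) (k : Space3) : ContDiff ℝ ∞ (minkowski k₀ k) := by
  have h : ContDiff ℝ ∞ spatial := by
    rw [contDiff_euclidean]
    intro i
    exact (contDiff_euclidean.1 contDiff_id) i.succ
  have h0 : ContDiff ℝ ∞ fun y : Spacetime => y 0 := (contDiff_euclidean.1 contDiff_id) 0
  exact (contDiff_const.mul h0).sub (contDiff_const.inner ℝ h)

/-- The product of a smooth function and a test function. -/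
def mulTest (g : Spacetime → ℝ) (hg : ContDiff ℝ ∞ g)
    (u : 𝓓((⊤ : Opens Spacetime), ℝ)) : 𝓓((⊤ : Opens Spacetime), ℝ) where
  toFun y := g y * u y
  contDiff' := hg.mul u.contDiff
  hasCompactSupport' := u.hasCompactSupport.mul_left
  tsupport_subset' := fun _ _ => trivial

theorem mulTest_apply (g : Spacetime → ℝ) (hg : ContDiff ℝ ∞ g)
    (u : 𝓓((⊤ : Opens Spacetime), ℝ)) (y : Spacetime) : mulTest g hg u y = g y * u y := rfl

/-- A smooth cutoff function: it is `1` on the ball of radius `|R| + 1` around `0` and `0` outside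
the ball of radius `|R| + 2`. -/
def cutoffBump (R : ℝ) : ContDiffBump (0 : Spacetime) where
  rIn := |R| + 1
  rOut := |R| + 2
  rIn_pos := by positivity
  rIn_lt_rOut := by linarith

/-- The cutoff function as a test function. -/
def cutoff (R : ℝ) : 𝓓((⊤ : Opens Spacetime), ℝ) where
  toFun := cutoffBump R
  contDiff' := (cutoffBump R).contDiff
  hasCompactSupport' := (cutoffBump R).hasCompactSupport
  tsupport_subset' := fun _ _ => trivial

/-- The distribution `f` applied to `y ↦ χ(y) exp(i (k₀ y₀ - k·y))`; a distribution acts on real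
test functions and is extended complex linearly. -/
def pairExp (f : 𝓓'((⊤ : Opens Spacetime), ℂ)) (χ : 𝓓((⊤ : Opens Spacetime), ℝ))
    (k₀ : ℝ) (k : Space3) : ℂ :=
  f (mulTest (fun y => Real.cos (minkowski k₀ k y)) (contDiff_minkowski k₀ k).cos χ) +
    Complex.I *
      f (mulTest (fun y => Real.sin (minkowski k₀ k y)) (contDiff_minkowski k₀ k).sin χ)

/-- The Fourier transform `f̂(k₀, k) = ∫ f(y) exp(i (k₀ y₀ - k·y)) dy` of a distribution supported
in the closed ball of radius `R` around `0`. By `fourierD_eq_pairExp` the choice of the cutoff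
function does not matter. -/
def fourierD (R : ℝ) (f : 𝓓'((⊤ : Opens Spacetime), ℂ)) (k₀ : ℝ) (k : Space3) : ℂ :=
  pairExp f (cutoff R) k₀ k

/-- A distribution vanishes on the test functions whose support does not meet its own. -/
theorem apply_eq_zero_of_disjoint (f : 𝓓'((⊤ : Opens Spacetime), ℂ))
    (u : 𝓓((⊤ : Opens Spacetime), ℝ)) (hu : Disjoint (tsupport u) (Distribution.dsupport f)) :
    f u = 0 := by
  have hK : IsCompact (tsupport u) := u.hasCompactSupport
  have hsub : tsupport u ⊆
      ⋃ a : { a | Distribution.IsVanishingOn f a ∧ IsOpen a }, (a : Set Spacetime) := by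
    rw [← sUnion_eq_iUnion, ← Distribution.dsupport_compl_eq]
    exact subset_compl_iff_disjoint_right.2 hu
  obtain ⟨T, hT⟩ := hK.elim_finite_subcover _ (fun a => a.2.2) hsub
  obtain ⟨ρ, hρ⟩ := SmoothPartitionOfUnity.exists_isSubordinate 𝓘(ℝ, Spacetime)
    (isClosed_tsupport u) (fun a : T => (a.1 : Set Spacetime)) (fun a => a.1.2.2)
    (by rwa [iUnion_subtype])
  have hsum : u = ∑ a : T, mulTest (ρ a) (ρ a).contMDiff.contDiff u := by
    ext y
    have h1 : (∑ a : T, mulTest (ρ a) (ρ a).contMDiff.contDiff u) y = ∑ a : T, ρ a y * u y := by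
      simp [mulTest_apply]
    rw [h1, ← Finset.sum_mul]
    by_cases hy : y ∈ tsupport u
    · have := ρ.sum_eq_one hy
      rw [finsum_eq_sum_of_fintype] at this
      rw [this, one_mul]
    · rw [image_eq_zero_of_notMem_tsupport hy, mul_zero]
  rw [hsum, map_sum]
  refine Finset.sum_eq_zero fun a _ => a.1.2.1 _ ?_
  exact (tsupport_mul_subset_left (f := ρ a) (g := u)).trans (hρ a)

/-- The Fourier transform may be computed with every cutoff function that is `1` near the support
of the distribution. -/
theorem fourierD_eq_pairExp (R : ℝ) (f : 𝓓'((⊤ : Opens Spacetime), ℂ))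
    (hf : Distribution.dsupport f ⊆ Metric.closedBall 0 R) (χ : 𝓓((⊤ : Opens Spacetime), ℝ))
    (hχ : ∀ᶠ y in 𝓝ˢ (Distribution.dsupport f), χ y = 1) (k₀ : ℝ) (k : Space3) :
    fourierD R f k₀ k = pairExp f χ k₀ k := by
  have key : ∀ (g : Spacetime → ℝ) (hg : ContDiff ℝ ∞ g),
      f (mulTest g hg (cutoff R)) = f (mulTest g hg χ) := by
    intro g hg
    rw [← sub_eq_zero, ← map_sub]
    refine apply_eq_zero_of_disjoint f _ (Set.disjoint_right.2 fun y hy => ?_)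
    rw [notMem_tsupport_iff_eventuallyEq]
    have h1 : ∀ᶠ z in 𝓝 y, χ z = 1 := eventually_nhdsSet_iff_forall.1 hχ y hy
    have h2 : ∀ᶠ z in 𝓝 y, cutoff R z = 1 := by
      have hy' : dist y 0 < |R| + 1 := by
        have := Metric.mem_closedBall.1 (hf hy)
        linarith [le_abs_self R]
      exact (cutoffBump R).eventuallyEq_one_of_mem_ball hy'
    filter_upwards [h1, h2] with z hz1 hz2
    simp [mulTest_apply, hz1, hz2]
  simp only [fourierD, pairExp, key]

/-- The relativistic energy `ω_p = √(|p|² + m²)`. -/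
def energy (m : ℝ) (p : Space3) : ℝ := √(‖p‖ ^ 2 + m ^ 2)

/-- The integrand `exp(-i (z ω_p - p·x)) f̂(ω_p, p) / (2 ω_p)` at the complex time `z`. -/
def onShellIntegrand (m R : ℝ) (f : 𝓓'((⊤ : Opens Spacetime), ℂ)) (z : ℂ) (x p : Space3) : ℂ :=
  1 / (2 * (energy m p : ℂ)) *
    Complex.exp (-Complex.I * (z * (energy m p : ℂ) - ((inner ℝ p x : ℝ) : ℂ))) *
    fourierD R f (energy m p) p

/-- `I_f(z, x)`. -/
def onShellIntegral (m R : ℝ) (f : 𝓓'((⊤ : Opens Spacetime), ℂ)) (z : ℂ) (x : Space3) : ℂ :=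
  ∫ p : Space3, onShellIntegrand m R f z x p

/-- The integrand `exp(-i (z ω_p - p·x)) exp(-b ω_p) f̂(-ω_p, p) / (2 ω_p)` at the complex time
`z`. -/
def dampedIntegrand (m R : ℝ) (f : 𝓓'((⊤ : Opens Spacetime), ℂ)) (b : ℝ) (z : ℂ)
    (x p : Space3) : ℂ :=
  1 / (2 * (energy m p : ℂ)) *
    Complex.exp (-Complex.I * (z * (energy m p : ℂ) - ((inner ℝ p x : ℝ) : ℂ))) *
    (Real.exp (-b * energy m p) : ℂ) * fourierD R f (-energy m p) p

/-- `I_f^b(z, x)`. -/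
def dampedIntegral (m R : ℝ) (f : 𝓓'((⊤ : Opens Spacetime), ℂ)) (b : ℝ) (z : ℂ)
    (x : Space3) : ℂ :=
  ∫ p : Space3, dampedIntegrand m R f b z x p

/-- At real times `I_f` is an oscillatory integral, that is, the tempered distribution
`φ ↦ ∫ f̂(ω_p, p) (∫ exp(-i (ω_p y₀ - p·y)) φ(y) dy) d³p / (2 ω_p)`. This is its integrand. -/
def oscillatoryIntegrand (m R : ℝ) (f : 𝓓'((⊤ : Opens Spacetime), ℂ)) (φ : 𝓢(Spacetime, ℂ))
    (p : Space3) : ℂ :=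
  1 / (2 * (energy m p : ℂ)) * fourierD R f (energy m p) p *
    ∫ y : Spacetime, Complex.exp (-Complex.I * (minkowski (energy m p) p y : ℂ)) * φ y

/-- The lower half plane `ℂ₋`. -/
def lowerHalfPlane : Set ℂ := {z | z.im < 0}

/-- Analyticity on `ℂ₋ × ℝ³`: jointly real analytic in time and space, and holomorphic in time. -/
def AnalyticOnLower (F : ℂ → Space3 → ℂ) : Prop :=
  AnalyticOnNhd ℝ (fun q : ℂ × Space3 => F q.1 q.2) (lowerHalfPlane ×ˢ univ) ∧
    ∀ x, DifferentiableOn ℂ (fun z => F z x) lowerHalfPlane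

end

/-! The distribution `f` has compact support, so its Fourier transform extends to an entire function
of the complex momentum, here a complex linear form `l` on spacetime paired with `f` through `χ exp
l`. Continuity of `f` on test functions with fixed support gives the Paley–Wiener estimate:
`expPair` and its derivative are at most `C (1 + ‖l‖)^N exp s` whenever `Re l ≤ s` on the support of
`χ` (`exists_expPair_bound`). At real momenta this is a polynomial bound.

Analyticity. For `Im z < 0` the factor `exp(Im z · ω_p)` beats every polynomial, and the exponential
series in `(z, x)` can be integrated term by term (`analyticAt_integral_mul_cexp`). The damping
`exp(-b ω_p)` is the shift `z ↦ z - ib`, which carries the closed lower half plane into the open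
one. For the boundary value, Fubini turns the pairing with `φ` into a momentum integral of `exp(-ε
ω_p)` times the Fourier transform of `φ` on the mass shell. That transform decays rapidly, and
dominated convergence applies.

Decay. Let `e` be a unit vector along `x` and rotate the mass-shell momentum by the imaginary boost
`it` in the `(k₀, k·e)` plane. On the shell the derivative along `e` is `-i/ω_p` times the
derivative in `t`, so with the invariant measure `d³p / (2 ω_p)` the `t`-derivative of the integrand
is `i/2` times a derivative along `e` and integrates to zero (`hasDerivAt_rotIntegral`). The contour
may thus be rotated as long as the integrand decays. With `u = r cos θ` and `‖x‖ = r sin θ`, the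
exponential acquires modulus `exp(-r ω_p cos(θ - t))`, while `f̂` grows at most like `exp(17/10 R
|sin t| ω_p)`. The net rate stays positive on `[0, θ]` when `r ≥ 2R`, and at `t = θ` it is at least
`r - 17/10 R`. Since `ω_p ≥ m`, this leaves `exp(-m r)` times an integrable weight
(`exists_norm_rotIntegral_zero_le`). -/

noncomputable section

/-! ### Order of a distribution on a fixed compact set and its complex-linear extension -/

/-- A distribution tested against `g χ` is controlled by finitely many derivatives of `g` on the
support of `χ`. -/
theorem exists_norm_apply_mulTest_le (f : 𝓓'((⊤ : Opens Spacetime), ℂ))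
    (χ : 𝓓((⊤ : Opens Spacetime), ℝ)) :
    ∃ (N : ℕ) (C : ℝ), 0 ≤ C ∧ ∀ (g : Spacetime → ℝ) (hg : ContDiff ℝ ∞ g) (B : ℝ), 0 ≤ B →
      (∀ j ≤ N, ∀ y ∈ tsupport χ, ‖iteratedFDeriv ℝ j g y‖ ≤ B) →
        ‖f (mulTest g hg χ)‖ ≤ C * B := by
  let K : Compacts Spacetime := ⟨tsupport χ, χ.hasCompactSupport⟩
  have hK : (K : Set Spacetime) ⊆ (⊤ : Opens Spacetime) := fun _ _ => trivial
  let F : 𝓓_{K}(Spacetime, ℝ) →ₗ[ℝ] ℂ :=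
    (f : 𝓓((⊤ : Opens Spacetime), ℝ) →L[ℝ] ℂ).toLinearMap ∘ₗ
      (TestFunction.ofSupportedInCLM ℝ hK).toLinearMap
  have hF : Continuous F :=
    (map_continuous f).comp (TestFunction.continuous_ofSupportedIn hK)
  -- On test functions supported in the fixed compact `K`, continuity means domination by finitely
  -- many derivative seminorms. The finite set `s` of their orders determines `N`.
  obtain ⟨s, C, -, hC⟩ := Seminorm.bound_of_continuous
    (ContDiffMapSupportedIn.withSeminorms ℝ Spacetime ℝ ⊤ K) ((normSeminorm ℝ ℂ).comp F)
    (continuous_norm.comp hF)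
  have hχb : ∀ k : ℕ, ∃ c : ℝ, ∀ y, ‖iteratedFDeriv ℝ k χ y‖ ≤ c := fun k =>
    (χ.hasCompactSupport.iteratedFDeriv k).exists_bound_of_continuous
      (χ.contDiff.continuous_iteratedFDeriv (mod_cast le_top))
  choose c hc using hχb
  have hc0 : ∀ k, 0 ≤ c k := fun k => (norm_nonneg _).trans (hc k 0)
  -- Leibniz constants: the contribution of the derivatives of `χ` to an `i`-th derivative of `g χ`.
  let T : ℕ → ℝ := fun i => ∑ j ∈ Finset.range (i + 1), (i.choose j : ℝ) * c (i - j)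
  have hT : ∀ i, 0 ≤ T i := fun i => Finset.sum_nonneg fun j _ => by
    have := hc0 (i - j); positivity
  refine ⟨s.sup id, C * ∑ i ∈ s, T i,
    mul_nonneg C.2 (Finset.sum_nonneg fun i _ => hT i), fun g hg B hB h => ?_⟩
  have hsupp : Function.support (fun y => g y * χ y) ⊆ K := fun y hy =>
    subset_tsupport χ (right_ne_zero_of_mul hy)
  let u : 𝓓_{K}(Spacetime, ℝ) := ContDiffMapSupportedIn.of_support_subset
    (hg.mul χ.contDiff) hsupp
  have h1 : ‖f (mulTest g hg χ)‖ ≤ C * (s.sup (ContDiffMapSupportedIn.seminorm ℝ Spacetime ℝ ⊤ K)) u :=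
    hC u
  have h2 : (s.sup (ContDiffMapSupportedIn.seminorm ℝ Spacetime ℝ ⊤ K)) u ≤ (∑ i ∈ s, T i) * B := by
    refine Seminorm.finset_sup_apply_le (mul_nonneg (Finset.sum_nonneg fun i _ => hT i) hB) ?_
    intro i hi
    refine le_trans ?_ (mul_le_mul_of_nonneg_right
      (Finset.single_le_sum (fun i _ => hT i) hi) hB)
    refine (ContDiffMapSupportedIn.seminorm_top_le_iff ℝ (mul_nonneg (hT i) hB) i u).2 ?_
    intro y hy
    refine (norm_iteratedFDeriv_mul_le hg χ.contDiff y (mod_cast le_top)).trans ?_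
    rw [Finset.sum_mul]
    refine Finset.sum_le_sum fun j hj => ?_
    have hj' : j ≤ s.sup id :=
      (Nat.lt_succ_iff.1 (Finset.mem_range.1 hj)).trans (Finset.le_sup (f := id) hi)
    calc (i.choose j : ℝ) * ‖iteratedFDeriv ℝ j g y‖ * ‖iteratedFDeriv ℝ (i - j) χ y‖
        ≤ (i.choose j : ℝ) * B * c (i - j) := by
          gcongr
          · exact h j hj' y hy
          · exact hc _ _
      _ = _ := by ring
  calc _ ≤ C * ((∑ i ∈ s, T i) * B) := h1.trans (by gcongr)
    _ = _ := by ring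

theorem contDiff_complex_re {g : Spacetime → ℂ} (hg : ContDiff ℝ ∞ g) :
    ContDiff ℝ ∞ fun y => (g y).re :=
  Complex.reCLM.contDiff.comp hg

theorem contDiff_complex_im {g : Spacetime → ℂ} (hg : ContDiff ℝ ∞ g) :
    ContDiff ℝ ∞ fun y => (g y).im :=
  Complex.imCLM.contDiff.comp hg

/-- The complex-linear extension of `g ↦ f (g χ)` to complex-valued functions. -/
def complexPair (f : 𝓓'((⊤ : Opens Spacetime), ℂ)) (χ : 𝓓((⊤ : Opens Spacetime), ℝ))
    (g : Spacetime → ℂ) (hg : ContDiff ℝ ∞ g) : ℂ :=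
  f (mulTest (fun y => (g y).re) (contDiff_complex_re hg) χ) +
    Complex.I * f (mulTest (fun y => (g y).im) (contDiff_complex_im hg) χ)

theorem complexPair_congr (f : 𝓓'((⊤ : Opens Spacetime), ℂ)) (χ : 𝓓((⊤ : Opens Spacetime), ℝ))
    {g g' : Spacetime → ℂ} (hg : ContDiff ℝ ∞ g) (hg' : ContDiff ℝ ∞ g') (h : ∀ y, g y = g' y) :
    complexPair f χ g hg = complexPair f χ g' hg' := by
  obtain rfl : g = g' := funext h
  rfl

theorem complexPair_add (f : 𝓓'((⊤ : Opens Spacetime), ℂ)) (χ : 𝓓((⊤ : Opens Spacetime), ℝ))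
    {g g' : Spacetime → ℂ} (hg : ContDiff ℝ ∞ g) (hg' : ContDiff ℝ ∞ g') :
    complexPair f χ (fun y => g y + g' y) (hg.add hg') =
      complexPair f χ g hg + complexPair f χ g' hg' := by
  have h1 : mulTest (fun y => (g y + g' y).re) (contDiff_complex_re (hg.add hg')) χ =
      mulTest (fun y => (g y).re) (contDiff_complex_re hg) χ +
        mulTest (fun y => (g' y).re) (contDiff_complex_re hg') χ := by
    ext y; simp [mulTest_apply, add_mul]
  have h2 : mulTest (fun y => (g y + g' y).im) (contDiff_complex_im (hg.add hg')) χ =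
      mulTest (fun y => (g y).im) (contDiff_complex_im hg) χ +
        mulTest (fun y => (g' y).im) (contDiff_complex_im hg') χ := by
    ext y; simp [mulTest_apply, add_mul]
  simp only [complexPair, h1, h2, map_add]
  ring

theorem complexPair_const_mul (f : 𝓓'((⊤ : Opens Spacetime), ℂ))
    (χ : 𝓓((⊤ : Opens Spacetime), ℝ)) (c : ℂ) {g : Spacetime → ℂ} (hg : ContDiff ℝ ∞ g) :
    complexPair f χ (fun y => c * g y) (contDiff_const.mul hg) = c * complexPair f χ g hg := by
  have h1 : mulTest (fun y => (c * g y).re) (contDiff_complex_re (contDiff_const.mul hg)) χ =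
      c.re • mulTest (fun y => (g y).re) (contDiff_complex_re hg) χ -
        c.im • mulTest (fun y => (g y).im) (contDiff_complex_im hg) χ := by
    ext y; simp [mulTest_apply]; ring
  have h2 : mulTest (fun y => (c * g y).im) (contDiff_complex_im (contDiff_const.mul hg)) χ =
      c.re • mulTest (fun y => (g y).im) (contDiff_complex_im hg) χ +
        c.im • mulTest (fun y => (g y).re) (contDiff_complex_re hg) χ := by
    ext y; simp [mulTest_apply]; ring
  simp only [complexPair, h1, h2, map_add, map_sub, map_smul, Complex.real_smul]
  conv_rhs => rw [← Complex.re_add_im c]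
  linear_combination (-(c.im : ℂ) * f (mulTest (fun y => (g y).im)
    (contDiff_complex_im hg) χ)) * Complex.I_sq

theorem exists_norm_complexPair_le (f : 𝓓'((⊤ : Opens Spacetime), ℂ))
    (χ : 𝓓((⊤ : Opens Spacetime), ℝ)) :
    ∃ (N : ℕ) (C : ℝ), 0 ≤ C ∧ ∀ (g : Spacetime → ℂ) (hg : ContDiff ℝ ∞ g) (B : ℝ), 0 ≤ B →
      (∀ j ≤ N, ∀ y ∈ tsupport χ, ‖iteratedFDeriv ℝ j g y‖ ≤ B) →
        ‖complexPair f χ g hg‖ ≤ C * B := by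
  obtain ⟨N, C, hC, h⟩ := exists_norm_apply_mulTest_le f χ
  refine ⟨N, 2 * C, by positivity, fun g hg B hB hgB => ?_⟩
  have key : ∀ L : ℂ →L[ℝ] ℝ, ‖L‖ ≤ 1 →
      ∀ j ≤ N, ∀ y ∈ tsupport χ, ‖iteratedFDeriv ℝ j (fun y => L (g y)) y‖ ≤ B := by
    intro L hL j hj y hy
    refine (L.norm_iteratedFDeriv_comp_left hg.contDiffAt (mod_cast le_top)).trans ?_
    exact (mul_le_mul hL (hgB j hj y hy) (norm_nonneg _) zero_le_one).trans (one_mul B).le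
  have h1 := h (fun y => (g y).re) (contDiff_complex_re hg) B hB
    (key Complex.reCLM Complex.reCLM_norm.le)
  have h2 := h (fun y => (g y).im) (contDiff_complex_im hg) B hB
    (key Complex.imCLM Complex.imCLM_norm.le)
  refine (norm_add_le _ _).trans ?_
  rw [norm_mul, Complex.norm_I, one_mul]
  linarith

/-! ### Derivatives of exponentials of linear forms -/

section ExponentialDerivatives

variable {E : Type*} [NormedAddCommGroup E] [NormedSpace ℝ E]

theorem contDiff_cexp_clm (l : E →L[ℝ] ℂ) : ContDiff ℝ ∞ fun y => Complex.exp (l y) :=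
  Complex.contDiff_exp.comp l.contDiff

/-- The derivative of `g` is `g'` followed by the fixed linear map `c ↦ c • l`, of norm at most
`‖l‖`. Each application peels one factor `l` off an iterated derivative. -/
theorem norm_iteratedFDeriv_succ_le_of_hasFDerivAt_smul {g g' : E → ℂ} (l : E →L[ℝ] ℂ)
    (hg' : ContDiff ℝ ∞ g')
    (h : ∀ y, HasFDerivAt g (g' y • l) y) (j : ℕ) (y : E) :
    ‖iteratedFDeriv ℝ (j + 1) g y‖ ≤ ‖l‖ * ‖iteratedFDeriv ℝ j g' y‖ := by
  rw [← norm_iteratedFDeriv_fderiv]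
  have h1 : fderiv ℝ g = (ContinuousLinearMap.lsmul ℝ ℂ : ℂ →L[ℝ] (E →L[ℝ] ℂ) →L[ℝ] (E →L[ℝ] ℂ)).flip l ∘ g' := by
    ext1 y; exact (h y).fderiv
  rw [h1]
  refine (ContinuousLinearMap.norm_iteratedFDeriv_comp_left _ hg'.contDiffAt
    (mod_cast le_top)).trans ?_
  gcongr
  refine ContinuousLinearMap.opNorm_le_bound _ (norm_nonneg _) fun c => ?_
  simp [norm_smul, mul_comm]

theorem hasFDerivAt_cexp_clm (l : E →L[ℝ] ℂ) (y : E) :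
    HasFDerivAt (fun y => Complex.exp (l y)) (Complex.exp (l y) • l) y :=
  l.hasFDerivAt.cexp

theorem norm_iteratedFDeriv_cexp_clm_le (l : E →L[ℝ] ℂ) (j : ℕ) (y : E) :
    ‖iteratedFDeriv ℝ j (fun y => Complex.exp (l y)) y‖ ≤ ‖l‖ ^ j * Real.exp (l y).re := by
  induction j with
  | zero => simp [Complex.norm_exp]
  | succ j ih =>
    refine (norm_iteratedFDeriv_succ_le_of_hasFDerivAt_smul l (contDiff_cexp_clm l)
      (hasFDerivAt_cexp_clm l) j y).trans ?_
    calc _ ≤ ‖l‖ * (‖l‖ ^ j * Real.exp (l y).re) := by gcongr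
      _ = _ := by ring

/-- Only orders 0 and 1 can be nonzero; the factor `1 + ‖y‖` serves all orders at once, as the
Leibniz bound below requires. -/
theorem norm_iteratedFDeriv_clm_le (l : E →L[ℝ] ℂ) (j : ℕ) (y : E) :
    ‖iteratedFDeriv ℝ j l y‖ ≤ ‖l‖ * (1 + ‖y‖) := by
  rcases j with _ | j
  · rw [norm_iteratedFDeriv_zero]
    exact (l.le_opNorm y).trans (by gcongr; linarith)
  · refine (norm_iteratedFDeriv_succ_le_of_hasFDerivAt_smul l (g' := fun _ => 1) contDiff_const
      (fun y => by simpa using l.hasFDerivAt) j y).trans ?_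
    gcongr
    rcases j with _ | j
    · simp
    · rw [iteratedFDeriv_succ_const]; simp; positivity

/-- The derivatives of `exp l - 1 - l` are quadratically small in `l`. -/
theorem norm_iteratedFDeriv_cexp_clm_sub_le (l : E →L[ℝ] ℂ) (hl : ‖l‖ ≤ 1) (j : ℕ) (y : E)
    (hy : ‖l‖ * ‖y‖ ≤ 1) :
    ‖iteratedFDeriv ℝ j (fun y => Complex.exp (l y) - 1 - l y) y‖ ≤
      ‖l‖ ^ 2 * (3 + 2 * ‖y‖ + ‖y‖ ^ 2) := by
  have hly : ‖l y‖ ≤ 1 := (l.le_opNorm y).trans hy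
  rcases j with _ | j
  · rw [norm_iteratedFDeriv_zero]
    calc _ ≤ ‖l y‖ ^ 2 := Complex.norm_exp_sub_one_sub_id_le hly
      _ ≤ (‖l‖ * ‖y‖) ^ 2 := by gcongr; exact l.le_opNorm y
      _ = ‖l‖ ^ 2 * ‖y‖ ^ 2 := by ring
      _ ≤ _ := by gcongr; linarith [norm_nonneg y]
  refine (norm_iteratedFDeriv_succ_le_of_hasFDerivAt_smul l
    (g' := fun y => Complex.exp (l y) - 1) ((contDiff_cexp_clm l).sub contDiff_const)
    (fun y => ?_) j y).trans ?_
  · have := ((hasFDerivAt_cexp_clm l y).sub_const 1).sub l.hasFDerivAt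
    refine HasFDerivAt.congr_fderiv this ?_
    ext v
    simp [sub_mul]
  rcases j with _ | j
  · rw [norm_iteratedFDeriv_zero]
    calc _ ≤ ‖l‖ * (2 * (‖l‖ * ‖y‖)) := by
          gcongr
          exact (Complex.norm_exp_sub_one_le hly).trans (by gcongr; exact l.le_opNorm y)
      _ = ‖l‖ ^ 2 * (2 * ‖y‖) := by ring
      _ ≤ _ := by gcongr; nlinarith [norm_nonneg y]
  -- From order two on, the constant and linear terms no longer matter, and two factors of `l` have
  -- come out of the exponential.
  · calc _ ≤ ‖l‖ * (‖l‖ * ‖iteratedFDeriv ℝ j (fun y => Complex.exp (l y)) y‖) := by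
          gcongr
          exact norm_iteratedFDeriv_succ_le_of_hasFDerivAt_smul l (contDiff_cexp_clm l)
            (fun y => (hasFDerivAt_cexp_clm l y).sub_const 1) j y
      _ ≤ ‖l‖ * (‖l‖ * (1 * Real.exp 1)) := by
          gcongr
          refine (norm_iteratedFDeriv_cexp_clm_le l j y).trans ?_
          gcongr
          · exact pow_le_one₀ (norm_nonneg _) hl
          · exact (Complex.re_le_norm _).trans hly
      _ = ‖l‖ ^ 2 * Real.exp 1 := by ring
      -- The constant 3 absorbs `e < 3`.
      _ ≤ _ := by
          gcongr
          nlinarith [norm_nonneg y, Real.exp_one_lt_d9]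

/-- Leibniz bound for a product with an exponential. -/
theorem norm_iteratedFDeriv_mul_cexp_clm_le (l : E →L[ℝ] ℂ) {g : E → ℂ} (hg : ContDiff ℝ ∞ g)
    {N j : ℕ} (hj : j ≤ N) (y : E) {A : ℝ} (hA : ∀ i, ‖iteratedFDeriv ℝ i g y‖ ≤ A) :
    ‖iteratedFDeriv ℝ j (fun y => g y * Complex.exp (l y)) y‖ ≤
      2 ^ N * A * ((1 + ‖l‖) ^ N * Real.exp (l y).re) := by
  have hA0 : 0 ≤ A := (norm_nonneg _).trans (hA 0)
  refine (norm_iteratedFDeriv_mul_le hg (contDiff_cexp_clm l) y (mod_cast le_top)).trans ?_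
  calc _ ≤ ∑ i ∈ Finset.range (j + 1), (j.choose i : ℝ) *
          (A * ((1 + ‖l‖) ^ N * Real.exp (l y).re)) := by
        refine Finset.sum_le_sum fun i hi => ?_
        rw [mul_assoc]
        gcongr
        · exact hA i
        · refine (norm_iteratedFDeriv_cexp_clm_le l _ y).trans ?_
          gcongr
          calc ‖l‖ ^ (j - i) ≤ (1 + ‖l‖) ^ (j - i) := by gcongr; linarith
            _ ≤ (1 + ‖l‖) ^ N := pow_le_pow_right₀ (by linarith [norm_nonneg l]) (by omega)
    _ = 2 ^ j * A * ((1 + ‖l‖) ^ N * Real.exp (l y).re) := by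
        rw [← Finset.sum_mul, ← Nat.cast_sum, Nat.sum_range_choose]; push_cast; ring
    _ ≤ _ := by gcongr; norm_num

end ExponentialDerivatives

/-! ### The Fourier–Laplace transform and its Paley–Wiener bounds -/

/-- The distribution `f` applied to `χ exp l`: an entire function of the linear form `l`. -/
def expPair (f : 𝓓'((⊤ : Opens Spacetime), ℂ)) (χ : 𝓓((⊤ : Opens Spacetime), ℝ))
    (l : Spacetime →L[ℝ] ℂ) : ℂ :=
  complexPair f χ (fun y => Complex.exp (l y)) (contDiff_cexp_clm l)

/-- The Paley–Wiener bounds for `expPair` and its complex derivative. -/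
theorem exists_expPair_bound (f : 𝓓'((⊤ : Opens Spacetime), ℂ))
    (χ : 𝓓((⊤ : Opens Spacetime), ℝ)) :
    ∃ (N : ℕ) (C : ℝ) (D : (Spacetime →L[ℝ] ℂ) → (Spacetime →L[ℝ] ℂ) →L[ℂ] ℂ), 0 ≤ C ∧ ∀ l,
      HasFDerivAt (expPair f χ) (D l) l ∧
      ∀ s : ℝ, (∀ y ∈ tsupport χ, (l y).re ≤ s) →
        ‖expPair f χ l‖ ≤ C * ((1 + ‖l‖) ^ N * Real.exp s) ∧
        ‖D l‖ ≤ C * ((1 + ‖l‖) ^ N * Real.exp s) := by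
  obtain ⟨N, C, hC, hbd⟩ := exists_norm_complexPair_le f χ
  obtain ⟨r, hr⟩ := χ.hasCompactSupport.isCompact.isBounded.exists_norm_le
  set r₀ := max r 0
  have hr₀ : ∀ y ∈ tsupport χ, ‖y‖ ≤ r₀ := fun y hy => (hr y hy).trans (le_max_left _ _)
  have hr₀0 : 0 ≤ r₀ := le_max_right _ _
  have hcd : ∀ (h l : Spacetime →L[ℝ] ℂ), ContDiff ℝ ∞ fun y => h y * Complex.exp (l y) :=
    fun h l => h.contDiff.mul (contDiff_cexp_clm l)
  have hD : ∀ (h l : Spacetime →L[ℝ] ℂ) (s : ℝ), (∀ y ∈ tsupport χ, (l y).re ≤ s) →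
      ‖complexPair f χ _ (hcd h l)‖ ≤
        (C * 2 ^ N * (1 + r₀)) * ((1 + ‖l‖) ^ N * Real.exp s) * ‖h‖ := by
    intro h l s hs
    refine (hbd _ _ (2 ^ N * (‖h‖ * (1 + r₀)) * ((1 + ‖l‖) ^ N * Real.exp s)) (by positivity)
      fun j hj y hy => ?_).trans (by apply le_of_eq; ring)
    refine (norm_iteratedFDeriv_mul_cexp_clm_le l h.contDiff hj y
      (A := ‖h‖ * (1 + r₀)) fun i => ?_).trans ?_
    · exact (norm_iteratedFDeriv_clm_le h i y).trans (by gcongr; exact hr₀ y hy)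
    · gcongr; exact hs y hy
  -- A crude bound on `Re l`, enough for continuity of `D l` and for differentiability; the sharp
  -- exponent `s` enters only in the final estimates.
  have hre : ∀ l : Spacetime →L[ℝ] ℂ, ∀ y ∈ tsupport χ, (l y).re ≤ ‖l‖ * r₀ := fun l y hy =>
    (Complex.re_le_norm _).trans ((l.le_opNorm y).trans (by gcongr; exact hr₀ y hy))
  let D : (Spacetime →L[ℝ] ℂ) → (Spacetime →L[ℝ] ℂ) →L[ℂ] ℂ := fun l =>
    LinearMap.mkContinuous
      { toFun := fun h => complexPair f χ _ (hcd h l)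
        map_add' := fun h h' => by
          rw [← complexPair_add]
          exact complexPair_congr f χ _ _ fun y => by simp [add_mul]
        map_smul' := fun c h => by
          rw [RingHom.id_apply, smul_eq_mul, ← complexPair_const_mul]
          exact complexPair_congr f χ _ _ fun y => by simp [mul_assoc] }
      ((C * 2 ^ N * (1 + r₀)) * ((1 + ‖l‖) ^ N * Real.exp (‖l‖ * r₀)))
      (fun h => hD h l _ (hre l))
  have hDapp : ∀ l h, D l h = complexPair f χ _ (hcd h l) := fun _ _ => rfl
  refine ⟨N, C * 2 ^ N * (1 + r₀), D, by positivity, fun l => ⟨?_, fun s hs => ⟨?_, ?_⟩⟩⟩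
  -- The Taylor remainder is the pairing with `(exp h - 1 - h) exp l`, whose derivatives on the
  -- support of `χ` are `O(‖h‖²)`.
  · have hO : (fun h => expPair f χ (l + h) - expPair f χ l - D l h) =O[𝓝 0]
        fun h : Spacetime →L[ℝ] ℂ => ‖h‖ ^ 2 := by
      refine Asymptotics.IsBigO.of_bound (C * (2 ^ N * (3 + 2 * r₀ + r₀ ^ 2) *
        ((1 + ‖l‖) ^ N * Real.exp (‖l‖ * r₀)))) ?_
      have hball : ∀ᶠ h : Spacetime →L[ℝ] ℂ in 𝓝 0, ‖h‖ < 1 / (1 + r₀) := by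
        have : Tendsto (fun h : Spacetime →L[ℝ] ℂ => ‖h‖) (𝓝 0) (𝓝 0) := by
          simpa using (continuous_norm (E := Spacetime →L[ℝ] ℂ)).tendsto 0
        exact this.eventually_lt_const (by positivity)
      filter_upwards [hball] with h hh
      have hh' : ‖h‖ * (1 + r₀) ≤ 1 := by
        rw [lt_div_iff₀ (by positivity)] at hh; exact hh.le
      have hh1 : ‖h‖ ≤ 1 := le_trans (le_mul_of_one_le_right (norm_nonneg _) (by linarith)) hh'
      have hcd2 : ContDiff ℝ ∞ fun y => Complex.exp (h y) - 1 - h y :=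
        ((contDiff_cexp_clm h).sub contDiff_const).sub h.contDiff
      have heq : expPair f χ (l + h) - expPair f χ l - D l h =
          complexPair f χ _ (hcd2.mul (contDiff_cexp_clm l)) := by
        rw [hDapp, sub_eq_iff_eq_add, sub_eq_iff_eq_add, expPair, expPair, ← complexPair_add,
          ← complexPair_add]
        refine complexPair_congr f χ _ _ fun y => ?_
        simp [Complex.exp_add]; ring
      rw [heq]
      refine (hbd _ _ (2 ^ N * (‖h‖ ^ 2 * (3 + 2 * r₀ + r₀ ^ 2)) *
        ((1 + ‖l‖) ^ N * Real.exp (‖l‖ * r₀))) (by positivity) fun j hj y hy => ?_).trans ?_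
      · have hyr := hr₀ y hy
        refine (norm_iteratedFDeriv_mul_cexp_clm_le l hcd2 hj y
          (A := ‖h‖ ^ 2 * (3 + 2 * r₀ + r₀ ^ 2)) fun i => ?_).trans ?_
        · refine (norm_iteratedFDeriv_cexp_clm_sub_le h hh1 i y ?_).trans (by gcongr)
          exact le_trans (by gcongr; linarith) hh'
        · gcongr; exact hre l y hy
      · rw [norm_pow, norm_norm]; apply le_of_eq; ring
    rw [hasFDerivAt_iff_isLittleO_nhds_zero]
    exact hO.trans_isLittleO (Asymptotics.isLittleO_norm_pow_id one_lt_two)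
  · refine (hbd _ _ ((1 + ‖l‖) ^ N * Real.exp s) (by positivity) fun j hj y hy => ?_).trans ?_
    · refine (norm_iteratedFDeriv_cexp_clm_le l j y).trans ?_
      gcongr
      · calc ‖l‖ ^ j ≤ (1 + ‖l‖) ^ j := by gcongr; linarith
          _ ≤ (1 + ‖l‖) ^ N := pow_le_pow_right₀ (by linarith [norm_nonneg l]) hj
      · exact hs y hy
    · gcongr
      calc C = C * 1 * 1 := by ring
        _ ≤ C * 2 ^ N * (1 + r₀) := by
          gcongr
          · exact one_le_pow₀ (by norm_num)
          · linarith
  · exact ContinuousLinearMap.opNorm_le_bound _ (by positivity) fun h => hD h l s hs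

/-! ### Real analyticity of superpositions of exponentials -/

section ParametricExponential

variable {α : Type*} [MeasurableSpace α] {μ : Measure α} {E : Type*} [NormedAddCommGroup E]
  [NormedSpace ℝ E]

/-- The `n`-th power of a linear form, as a multilinear map. -/
def clmPow (n : ℕ) (l : E →L[ℝ] ℂ) : E [×n]→L[ℝ] ℂ :=
  (ContinuousMultilinearMap.mkPiAlgebra ℝ (Fin n) ℂ).compContinuousLinearMap fun _ => l

theorem clmPow_apply (n : ℕ) (l : E →L[ℝ] ℂ) (q : E) : clmPow n l (fun _ => q) = l q ^ n := by
  simp [clmPow]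

theorem norm_clmPow_le (n : ℕ) (l : E →L[ℝ] ℂ) : ‖clmPow n l‖ ≤ ‖l‖ ^ n := by
  refine (ContinuousMultilinearMap.norm_compContinuousLinearMap_le _ _).trans ?_
  simp

theorem continuous_clmPow (n : ℕ) : Continuous (clmPow n : (E →L[ℝ] ℂ) → E [×n]→L[ℝ] ℂ) := by
  have h := (ContinuousMultilinearMap.compContinuousLinearMapContinuousMultilinear ℝ
    (fun _ : Fin n => E) (fun _ : Fin n => ℂ) ℂ).cont
  exact (h.comp (continuous_pi fun _ => continuous_id)).clm_apply continuous_const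

/-- The exponential series is integrated term by term. All partial sums of norms on the ball of
radius `r` are dominated by `‖a‖ exp(r ‖L‖)`, which gives both the radius of convergence and the
exchange of sum and integral. -/
theorem analyticAt_zero_integral_mul_cexp {a : α → ℂ} {L : α → E →L[ℝ] ℂ}
    (ha : AEStronglyMeasurable a μ) (hL : AEStronglyMeasurable L μ) {r : ℝ} (hr : 0 < r)
    (hint : Integrable (fun p => ‖a p‖ * Real.exp (r * ‖L p‖)) μ) :
    AnalyticAt ℝ (fun q => ∫ p, a p * Complex.exp (L p q) ∂μ) 0 := by
  let P : ∀ n : ℕ, α → E [×n]→L[ℝ] ℂ := fun n p => (a p * ((n.factorial : ℂ))⁻¹) • clmPow n (L p)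
  have hPm : ∀ n, AEStronglyMeasurable (P n) μ := fun n =>
    (ha.mul_const _).smul ((continuous_clmPow n).comp_aestronglyMeasurable hL)
  have hPn : ∀ n p, ‖P n p‖ * r ^ n ≤ ‖a p‖ * ((r * ‖L p‖) ^ n / n.factorial) := by
    intro n p
    calc ‖P n p‖ * r ^ n = ‖a p‖ * (n.factorial : ℝ)⁻¹ * ‖clmPow n (L p)‖ * r ^ n := by
          rw [norm_smul, norm_mul, norm_inv, Complex.norm_natCast]
      _ ≤ ‖a p‖ * (n.factorial : ℝ)⁻¹ * ‖L p‖ ^ n * r ^ n := by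
          gcongr; exact norm_clmPow_le n _
      _ = _ := by rw [mul_pow]; ring
  have hPe : ∀ n p, ‖P n p‖ * r ^ n ≤ ‖a p‖ * Real.exp (r * ‖L p‖) := fun n p =>
    (hPn n p).trans (by gcongr; exact Real.pow_div_factorial_le_exp _ (by positivity) n)
  have hPi : ∀ n, Integrable (P n) μ := fun n => by
    refine (hint.mul_const ((r ^ n)⁻¹)).mono' (hPm n) (.of_forall fun p => ?_)
    rw [← div_eq_mul_inv, le_div_iff₀ (by positivity)]
    exact hPe n p
  let S : FormalMultilinearSeries ℝ E ℂ := fun n => ∫ p, P n p ∂μ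
  refine HasFPowerSeriesAt.analyticAt (p := S) ⟨(r.toNNReal : ENNReal), ?_, by simpa using hr, ?_⟩
  · refine S.le_radius_of_bound (∫ p, ‖a p‖ * Real.exp (r * ‖L p‖) ∂μ) fun n => ?_
    rw [Real.coe_toNNReal r hr.le]
    calc ‖S n‖ * r ^ n ≤ (∫ p, ‖P n p‖ ∂μ) * r ^ n := by
          gcongr; exact norm_integral_le_integral_norm _
      _ = ∫ p, ‖P n p‖ * r ^ n ∂μ := (integral_mul_const _ _).symm
      _ ≤ _ := integral_mono ((hPi n).norm.mul_const _) hint (hPe n)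
  · intro q hq
    have hq' : ‖q‖ ≤ r := by
      rw [Metric.mem_eball, edist_zero_right, enorm_lt_coe, ← NNReal.coe_lt_coe,
        Real.coe_toNNReal r hr.le] at hq
      exact hq.le
    have hSq : ∀ n, S n (fun _ => q) = ∫ p, P n p (fun _ => q) ∂μ := fun n =>
      ((ContinuousMultilinearMap.apply ℝ (fun _ : Fin n => E) ℂ
        (fun _ => q)).integral_comp_comm (hPi n)).symm
    have hsum : ∀ p, ∑' n, P n p (fun _ => q) = a p * Complex.exp (L p (0 + q)) := by
      intro p
      have h1 : ∀ n, P n p (fun _ => q) = a p * (L p q ^ n / n.factorial) := fun n => by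
        simp [P, clmPow_apply]; ring
      simp_rw [h1, zero_add, tsum_mul_left, Complex.exp_eq_exp_ℂ, NormedSpace.exp_eq_tsum_div]
    have hle : ∀ n p, ‖P n p (fun _ => q)‖ ≤ ‖a p‖ * ((r * ‖L p‖) ^ n / n.factorial) := by
      intro n p
      refine le_trans ?_ (hPn n p)
      refine (ContinuousMultilinearMap.le_opNorm _ _).trans ?_
      rw [Fin.prod_const]
      gcongr
    have hPqi : ∀ n, Integrable (fun p => P n p (fun _ => q)) μ := fun n =>
      (ContinuousMultilinearMap.apply ℝ (fun _ : Fin n => E) ℂ (fun _ => q)).integrable_comp (hPi n)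
    have := hasSum_integral_of_summable_integral_norm hPqi (summable_of_sum_le
      (c := ∫ p, ‖a p‖ * Real.exp (r * ‖L p‖) ∂μ)
      (fun n => integral_nonneg fun p => norm_nonneg _) fun u => ?_)
    · simpa only [hSq, hsum] using this
    · rw [← integral_finsetSum _ fun n _ => (hPqi n).norm]
      refine integral_mono (integrable_finsetSum _ fun n _ => (hPqi n).norm) hint fun p => ?_
      obtain ⟨k, hk⟩ := u.exists_nat_subset_range
      calc ∑ n ∈ u, ‖P n p (fun _ => q)‖
          ≤ ∑ n ∈ u, ‖a p‖ * ((r * ‖L p‖) ^ n / n.factorial) :=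
            Finset.sum_le_sum fun n _ => hle n p
        _ ≤ ∑ n ∈ Finset.range k, ‖a p‖ * ((r * ‖L p‖) ^ n / n.factorial) :=
            Finset.sum_le_sum_of_subset_of_nonneg hk fun _ _ _ => by positivity
        _ ≤ _ := by
            rw [← Finset.mul_sum]
            gcongr
            exact Real.sum_le_exp_of_nonneg (by positivity) k

/-- An absolutely convergent superposition of exponentials is real analytic. -/
theorem analyticAt_integral_mul_cexp {a : α → ℂ} {L : α → E →L[ℝ] ℂ}
    (ha : AEStronglyMeasurable a μ) (hL : AEStronglyMeasurable L μ) {r : ℝ} (hr : 0 < r) (q₀ : E)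
    (hint : Integrable (fun p => ‖a p‖ * Real.exp (L p q₀).re * Real.exp (r * ‖L p‖)) μ) :
    AnalyticAt ℝ (fun q => ∫ p, a p * Complex.exp (L p q) ∂μ) q₀ := by
  have hm : AEStronglyMeasurable (fun p => a p * Complex.exp (L p q₀)) μ :=
    ha.mul (Complex.continuous_exp.comp_aestronglyMeasurable
      ((ContinuousLinearMap.apply ℝ ℂ q₀).continuous.comp_aestronglyMeasurable hL))
  -- Translation to the origin: `exp(L q₀)` is absorbed into the amplitude.
  have h0 := analyticAt_zero_integral_mul_cexp (μ := μ) hm hL hr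
    (by simpa only [norm_mul, Complex.norm_exp] using hint)
  have h1 : AnalyticAt ℝ (fun q : E => q - q₀) q₀ := analyticAt_id.sub analyticAt_const
  have h2 := AnalyticAt.comp_of_eq h0 h1 (sub_self q₀)
  refine h2.congr (.of_forall fun q => ?_)
  simp only [Function.comp_apply]
  congr 1
  ext p
  rw [mul_assoc, ← Complex.exp_add, ← map_add, add_sub_cancel]

end ParametricExponential

/-! ### Integrable weights on the mass shell -/

section Weights

theorem norm_le_energy (m : ℝ) (p : Space3) : ‖p‖ ≤ energy m p :=
  Real.le_sqrt_of_sq_le (by nlinarith)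

theorem energy_nonneg (m : ℝ) (p : Space3) : 0 ≤ energy m p := Real.sqrt_nonneg _

theorem le_energy (m : ℝ) (p : Space3) : m ≤ energy m p :=
  Real.le_sqrt_of_sq_le (by nlinarith [norm_nonneg p])

theorem continuous_energy (m : ℝ) : Continuous (energy m) := by
  unfold energy; fun_prop

theorem exists_one_add_pow_le_exp (N : ℕ) {a : ℝ} (ha : 0 < a) :
    ∃ C : ℝ, 0 ≤ C ∧ ∀ t : ℝ, 0 ≤ t → (1 + t) ^ N ≤ C * Real.exp (a * t) := by
  refine ⟨N.factorial / a ^ N * Real.exp a, by positivity, fun t ht => ?_⟩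
  have h := Real.pow_div_factorial_le_exp (a * (1 + t)) (by positivity) N
  rw [div_le_iff₀ (by positivity), mul_pow] at h
  rw [mul_assoc, ← Real.exp_add, div_mul_eq_mul_div, le_div_iff₀ (by positivity)]
  calc _ = a ^ N * (1 + t) ^ N := by ring
    _ ≤ _ := h
    _ = _ := by rw [mul_comm]; ring_nf

/-- In polar coordinates the Jacobian `t²` cancels the singularity `1/t`. This is what admits the
massless case. -/
theorem integrable_norm_inv_mul_exp {δ : ℝ} (hδ : 0 < δ) :
    Integrable fun p : Space3 => ‖p‖⁻¹ * Real.exp (-δ * ‖p‖) := by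
  refine (integrable_fun_norm_addHaar (volume : Measure Space3)
    (f := fun t => t⁻¹ * Real.exp (-δ * t))).2 ?_
  have h1 : IntegrableOn (fun t : ℝ => t * Real.exp (-δ * t)) (Ioi 0) := by
    obtain ⟨C, hC, h⟩ := exists_one_add_pow_le_exp 1 (half_pos hδ)
    refine ((exp_neg_integrableOn_Ioi 0 (half_pos hδ)).const_mul C).mono'
      (by fun_prop) ((ae_restrict_iff' measurableSet_Ioi).2 (.of_forall fun t ht => ?_))
    have ht0 : (0 : ℝ) < t := ht
    rw [Real.norm_of_nonneg (by positivity)]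
    calc t * Real.exp (-δ * t) ≤ (C * Real.exp (δ / 2 * t)) * Real.exp (-δ * t) := by
          gcongr
          have := h t ht0.le
          linarith
      _ = C * Real.exp (-(δ / 2) * t) := by
          rw [mul_assoc, ← Real.exp_add]; ring_nf
  refine h1.congr_fun (fun t ht => ?_) measurableSet_Ioi
  have ht0 : t ≠ 0 := ne_of_gt ht
  simp only [finrank_euclideanSpace, Fintype.card_fin, smul_eq_mul]
  field_simp

/-- The weights that dominate the integrals over the mass shell are integrable. -/
theorem integrable_shell_weight (m : ℝ) (N : ℕ) {δ : ℝ} (hδ : 0 < δ) :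
    Integrable fun p : Space3 =>
      (2 * energy m p)⁻¹ * ((1 + energy m p) ^ N * Real.exp (-δ * energy m p)) := by
  -- Half of the exponential rate pays for the polynomial factor.
  obtain ⟨C, hC, h⟩ := exists_one_add_pow_le_exp N (half_pos hδ)
  refine ((integrable_norm_inv_mul_exp (half_pos hδ)).const_mul C).mono'
    (Measurable.aestronglyMeasurable ?_) ?_
  · have := (continuous_energy m).measurable
    fun_prop
  -- The origin is discarded because `‖0‖⁻¹ = 0` by convention, so the majorant vanishes there,
  -- whereas the weight does not if `m ≠ 0`.
  have h0 : ∀ᵐ p : Space3, p ≠ 0 := by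
    simp [ae_iff]
  filter_upwards [h0] with p hp
  have hp' : 0 < ‖p‖ := norm_pos_iff.2 hp
  have hω := norm_le_energy m p
  have hω0 := energy_nonneg m p
  rw [Real.norm_of_nonneg (by positivity)]
  calc (2 * energy m p)⁻¹ * ((1 + energy m p) ^ N * Real.exp (-δ * energy m p))
      ≤ ‖p‖⁻¹ * ((C * Real.exp (δ / 2 * energy m p)) * Real.exp (-δ * energy m p)) := by
        gcongr
        · linarith
        · exact h _ hω0
    _ = C * (‖p‖⁻¹ * Real.exp (-(δ / 2) * energy m p)) := by
        rw [mul_assoc C, ← Real.exp_add]; ring_nf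
    _ ≤ _ := by
        gcongr ?_ * (?_ * Real.exp ?_)
        nlinarith

end Weights

/-! ### Mass-shell integrals with polynomially bounded amplitudes -/

section MassShell

/-- The integrand of `∫ exp(-i (z ω_p - p·x)) F(p) d³p / (2 ω_p)`. -/
def shellIntegrand (m : ℝ) (F : Space3 → ℂ) (z : ℂ) (x p : Space3) : ℂ :=
  1 / (2 * (energy m p : ℂ)) *
    Complex.exp (-Complex.I * (z * (energy m p : ℂ) - ((inner ℝ p x : ℝ) : ℂ))) * F p

/-- The mass-shell integral `∫ exp(-i (z ω_p - p·x)) F(p) d³p / (2 ω_p)`. -/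
def shellIntegral (m : ℝ) (F : Space3 → ℂ) (z : ℂ) (x : Space3) : ℂ :=
  ∫ p : Space3, shellIntegrand m F z x p

variable {m : ℝ} {F : Space3 → ℂ}

theorem norm_shellIntegrand (z : ℂ) (x p : Space3) :
    ‖shellIntegrand m F z x p‖ =
      (2 * energy m p)⁻¹ * (‖F p‖ * Real.exp (z.im * energy m p)) := by
  have h : (-Complex.I * (z * (energy m p : ℂ) - ((inner ℝ p x : ℝ) : ℂ))).re =
      z.im * energy m p := by simp
  rw [shellIntegrand, norm_mul, norm_mul, Complex.norm_exp, h, norm_div, norm_one, norm_mul,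
    Complex.norm_real, Real.norm_of_nonneg (energy_nonneg m p)]
  simp
  ring

theorem measurable_shellIntegrand (hF : Continuous F) (z : ℂ) (x : Space3) :
    Measurable (shellIntegrand m F z x) := by
  have h1 := (continuous_energy m).measurable
  have h2 := hF.measurable
  unfold shellIntegrand
  fun_prop

variable {C : ℝ} {N : ℕ}

theorem integrable_shellIntegrand (hF : Continuous F)
    (hb : ∀ p, ‖F p‖ ≤ C * (1 + energy m p) ^ N) {z : ℂ} (hz : z.im < 0) (x : Space3) :
    Integrable (shellIntegrand m F z x) := by
  refine ((integrable_shell_weight m N (neg_pos.2 hz)).const_mul C).mono'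
    (measurable_shellIntegrand hF z x).aestronglyMeasurable (.of_forall fun p => ?_)
  have hω := energy_nonneg m p
  rw [norm_shellIntegrand]
  calc _ ≤ (2 * energy m p)⁻¹ * ((C * (1 + energy m p) ^ N) * Real.exp (z.im * energy m p)) := by
        gcongr; exact hb p
    _ = _ := by rw [neg_neg]; ring

/-- The exponent `-i (z ω_p - p·x)` as a linear form in `(z, x)`. -/
def phaseForm (m : ℝ) (p : Space3) : ℂ × Space3 →L[ℝ] ℂ :=
  (-Complex.I * (energy m p : ℂ)) • ContinuousLinearMap.fst ℝ ℂ Space3 +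
    Complex.I • (Complex.ofRealCLM ∘L innerSL ℝ p ∘L ContinuousLinearMap.snd ℝ ℂ Space3)

theorem phaseForm_apply (p : Space3) (q : ℂ × Space3) :
    phaseForm m p q =
      -Complex.I * (q.1 * (energy m p : ℂ) - ((inner ℝ p q.2 : ℝ) : ℂ)) := by
  simp [phaseForm]; ring

theorem norm_phaseForm_le (p : Space3) : ‖phaseForm m p‖ ≤ 2 * energy m p := by
  have hω := energy_nonneg m p
  refine ContinuousLinearMap.opNorm_le_bound _ (by positivity) fun q => ?_
  rw [phaseForm_apply, norm_mul, norm_neg, Complex.norm_I, one_mul]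
  refine (norm_sub_le _ _).trans ?_
  rw [norm_mul, Complex.norm_real, Complex.norm_real, Real.norm_of_nonneg hω]
  have h1 : ‖(inner ℝ p q.2 : ℝ)‖ ≤ energy m p * ‖q‖ :=
    (norm_inner_le_norm p q.2).trans
      (mul_le_mul (norm_le_energy m p) (norm_snd_le q) (norm_nonneg _) hω)
  have h2 : ‖q.1‖ * energy m p ≤ ‖q‖ * energy m p := by gcongr; exact norm_fst_le q
  linarith

theorem continuous_phaseForm : Continuous (phaseForm m) := by
  have h1 := continuous_energy m
  unfold phaseForm
  fun_prop

theorem analyticOnNhd_shellIntegral (hF : Continuous F)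
    (hb : ∀ p, ‖F p‖ ≤ C * (1 + energy m p) ^ N) :
    AnalyticOnNhd ℝ (fun q : ℂ × Space3 => shellIntegral m F q.1 q.2)
      (lowerHalfPlane ×ˢ univ) := by
  rintro ⟨z, x⟩ ⟨hz, -⟩
  have hz' : z.im < 0 := hz
  have hm := (continuous_energy m).measurable
  have hFm := hF.measurable
  -- Since `‖phaseForm‖ ≤ 2 ω_p`, the radius `-Im z / 4` costs at most half of the decay `exp(Im z ·
  -- ω_p)`.
  have h := analyticAt_integral_mul_cexp (μ := (volume : Measure Space3))
    (a := fun p => 1 / (2 * (energy m p : ℂ)) * F p) (L := phaseForm m) (r := -z.im / 4)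
    (by fun_prop) continuous_phaseForm.aestronglyMeasurable (by linarith) (z, x) ?_
  · refine h.congr (.of_forall fun q => ?_)
    simp only [shellIntegral, shellIntegrand, phaseForm_apply]
    congr 1
    ext p
    ring
  · refine ((integrable_shell_weight m N (δ := -z.im / 2) (by linarith)).const_mul C).mono' ?_
      (.of_forall fun p => ?_)
    · have h2 : Measurable fun p : Space3 => ‖phaseForm m p‖ :=
        (continuous_phaseForm (m := m)).norm.measurable
      have h3 : Measurable fun p : Space3 => phaseForm m p (z, x) :=
        (continuous_phaseForm.clm_apply continuous_const).measurable
      exact Measurable.aestronglyMeasurable (by fun_prop)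
    have hω := energy_nonneg m p
    have hre : (phaseForm m p (z, x)).re = z.im * energy m p := by simp [phaseForm_apply]
    rw [Real.norm_of_nonneg (by positivity), hre, norm_mul, norm_div, norm_one, norm_mul,
      Complex.norm_real, Real.norm_of_nonneg hω, Complex.norm_ofNat, one_div, mul_assoc,
      ← Real.exp_add]
    have hCN : 0 ≤ C * (1 + energy m p) ^ N := (norm_nonneg _).trans (hb p)
    calc _ ≤ (2 * energy m p)⁻¹ * (C * (1 + energy m p) ^ N) *
          Real.exp (-(-z.im / 2) * energy m p) := by
          gcongr
          · exact hb p
          · nlinarith [mul_le_mul_of_nonneg_left (norm_phaseForm_le (m := m) p)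
              (show 0 ≤ -z.im / 4 by linarith)]
      _ = _ := by ring

theorem hasDerivAt_shellIntegrand (z : ℂ) (x p : Space3) :
    HasDerivAt (fun z => shellIntegrand m F z x p)
      (-Complex.I * (energy m p : ℂ) * shellIntegrand m F z x p) z := by
  have h1 : HasDerivAt (fun z : ℂ => -Complex.I * (z * (energy m p : ℂ) -
      ((inner ℝ p x : ℝ) : ℂ))) (-Complex.I * (1 * (energy m p : ℂ))) z :=
    (((hasDerivAt_id z).mul_const _).sub_const _).const_mul _
  have h2 := (h1.cexp.const_mul (1 / (2 * (energy m p : ℂ)))).mul_const (F p)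
  refine h2.congr_deriv ?_
  simp only [shellIntegrand]; ring

theorem differentiableOn_shellIntegral (hF : Continuous F)
    (hb : ∀ p, ‖F p‖ ≤ C * (1 + energy m p) ^ N) (x : Space3) :
    DifferentiableOn ℂ (fun z => shellIntegral m F z x) lowerHalfPlane := by
  intro z hz
  have hz' : z.im < 0 := hz
  -- In the disc of radius `-Im z / 2`, half of the decay rate at `z` survives and dominates all the
  -- derivatives.
  have hball : ∀ w ∈ Metric.ball z (-z.im / 2), w.im ≤ -(-z.im / 2) := by
    intro w hw
    have h1 : |(w - z).im| < -z.im / 2 :=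
      (Complex.abs_im_le_norm _).trans_lt (by simpa [dist_eq_norm] using hw)
    rw [Complex.sub_im] at h1
    linarith [(abs_lt.1 h1).2]
  have hωm := (continuous_energy m).measurable
  have hsm := measurable_shellIntegrand (m := m) hF z x
  have h := hasDerivAt_integral_of_dominated_loc_of_deriv_le (μ := (volume : Measure Space3))
    (F := fun z p => shellIntegrand m F z x p)
    (F' := fun z p => -Complex.I * (energy m p : ℂ) * shellIntegrand m F z x p)
    (bound := fun p => C * ((2 * energy m p)⁻¹ *
      ((1 + energy m p) ^ (N + 1) * Real.exp (-(-z.im / 2) * energy m p))))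
    (Metric.ball_mem_nhds z (show 0 < -z.im / 2 by linarith))
    (.of_forall fun w => (measurable_shellIntegrand hF w x).aestronglyMeasurable)
    (integrable_shellIntegrand hF hb hz' x)
    (Measurable.aestronglyMeasurable (by fun_prop))
    (.of_forall fun p w hw => ?_)
    ((integrable_shell_weight m (N + 1) (by linarith)).const_mul C)
    (.of_forall fun p w _ => hasDerivAt_shellIntegrand w x p)
  · exact h.2.differentiableAt.differentiableWithinAt
  · have hω := energy_nonneg m p
    have hCN : 0 ≤ C * (1 + energy m p) ^ N := (norm_nonneg _).trans (hb p)
    rw [norm_mul, norm_shellIntegrand, norm_mul, norm_neg, Complex.norm_I, Complex.norm_real,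
      Real.norm_of_nonneg hω]
    calc _ ≤ 1 * (1 + energy m p) * ((2 * energy m p)⁻¹ * ((C * (1 + energy m p) ^ N) *
          Real.exp (-(-z.im / 2) * energy m p))) := by
          gcongr
          · linarith
          · exact hb p
          · exact hball w hw
      _ = _ := by ring

/-! ### The boundary value at real times -/

/-- At real times there is no exponential damping. The cube makes the radial integrand at most `(1 +
t)⁻²`, after `t²` has cancelled the singularity at the origin. -/
theorem integrable_inv_energy_mul_inv (m : ℝ) :
    Integrable fun p : Space3 => (2 * energy m p)⁻¹ * ((1 + energy m p) ^ 3)⁻¹ := by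
  have h1 : Integrable fun p : Space3 => ‖p‖⁻¹ * ((1 + ‖p‖) ^ 3)⁻¹ := by
    refine (integrable_fun_norm_addHaar (volume : Measure Space3)
      (f := fun t => t⁻¹ * ((1 + t) ^ 3)⁻¹)).2 ?_
    have h2 : Integrable fun t : ℝ => (1 + ‖t‖) ^ (-(2 : ℝ)) :=
      integrable_one_add_norm (by simp)
    refine h2.integrableOn.mono' (Measurable.aestronglyMeasurable (by fun_prop))
      ((ae_restrict_iff' measurableSet_Ioi).2 (.of_forall fun t ht => ?_))
    have ht0 : (0 : ℝ) < t := ht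
    rw [Real.rpow_neg (by positivity), Real.norm_of_nonneg ht0.le, Real.rpow_ofNat,
      finrank_euclideanSpace, Fintype.card_fin, smul_eq_mul, Real.norm_of_nonneg (by positivity)]
    calc t ^ (3 - 1) * (t⁻¹ * ((1 + t) ^ 3)⁻¹) = t / (1 + t) * ((1 + t) ^ 2)⁻¹ := by
          field_simp
      _ ≤ 1 * ((1 + t) ^ 2)⁻¹ := by
          gcongr
          rw [div_le_one (by positivity)]; linarith
      _ = _ := one_mul _
  refine h1.mono' (Measurable.aestronglyMeasurable ?_) ?_
  · have := (continuous_energy m).measurable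
    fun_prop
  have h0 : ∀ᵐ p : Space3, p ≠ 0 := by
    simp [ae_iff]
  filter_upwards [h0] with p hp
  have hp' : 0 < ‖p‖ := norm_pos_iff.2 hp
  have hω := norm_le_energy m p
  have hω0 := energy_nonneg m p
  rw [Real.norm_of_nonneg (by positivity)]
  gcongr
  linarith

theorem continuous_spatial : Continuous spatial := by
  unfold spatial; fun_prop

/-- The wave vector whose Fourier character is `exp(-i (ω_p y₀ - p·y))`. -/
def waveVector (m : ℝ) (p : Space3) : Spacetime :=
  (2 * Real.pi)⁻¹ • WithLp.toLp 2 (Fin.cons (energy m p) fun i => -p i)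

theorem two_pi_mul_inner_waveVector (p : Space3) (y : Spacetime) :
    2 * Real.pi * inner ℝ y (waveVector m p) = minkowski (energy m p) p y := by
  rw [waveVector, inner_smul_right, mul_inv_cancel_left₀ (by positivity)]
  simp [minkowski, spatial, PiLp.inner_apply, Fin.sum_univ_succ]
  ring

theorem continuous_waveVector : Continuous (waveVector m) := by
  have h1 := continuous_energy m
  unfold waveVector
  have h2 : Continuous fun p : Space3 => (Fin.cons (energy m p) fun i => -p i : Fin 4 → ℝ) := by
    refine continuous_pi fun i => Fin.cases ?_ (fun j => ?_) i
    · simpa using h1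
    · simp only [Fin.cons_succ]; fun_prop
  fun_prop

theorem energy_le_norm_waveVector (p : Space3) :
    1 + energy m p ≤ 2 * Real.pi * (1 + ‖waveVector m p‖) := by
  have h1 : ‖waveVector m p 0‖ ≤ ‖waveVector m p‖ := PiLp.norm_apply_le _ 0
  have h2 : waveVector m p 0 = (2 * Real.pi)⁻¹ * energy m p := by simp [waveVector]
  rw [h2, norm_mul, Real.norm_of_nonneg (by positivity),
    Real.norm_of_nonneg (energy_nonneg m p), inv_mul_le_iff₀ (by positivity)] at h1
  nlinarith [Real.pi_gt_three]

/-- The Fourier transform of a Schwartz function on the mass shell. -/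
def shellFourier (m : ℝ) (φ : 𝓢(Spacetime, ℂ)) (p : Space3) : ℂ :=
  ∫ y : Spacetime, Complex.exp (-Complex.I * (minkowski (energy m p) p y : ℂ)) * φ y

theorem shellFourier_eq (φ : 𝓢(Spacetime, ℂ)) (p : Space3) :
    shellFourier m φ p = FourierTransform.fourier φ (waveVector m p) := by
  rw [SchwartzMap.fourier_coe, Real.fourier_eq', shellFourier]
  congr 1
  ext y
  rw [← two_pi_mul_inner_waveVector, smul_eq_mul]
  congr 2
  push_cast
  ring

theorem continuous_shellFourier (φ : 𝓢(Spacetime, ℂ)) : Continuous (shellFourier m φ) := by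
  simp_rw [funext (shellFourier_eq (m := m) φ)]
  exact (FourierTransform.fourier φ).continuous.comp continuous_waveVector

theorem exists_norm_shellFourier_le (m : ℝ) (φ : 𝓢(Spacetime, ℂ)) (k : ℕ) :
    ∃ C : ℝ, 0 ≤ C ∧ ∀ p, ‖shellFourier m φ p‖ ≤ C * ((1 + energy m p) ^ k)⁻¹ := by
  let ψ : 𝓢(Spacetime, ℂ) := FourierTransform.fourier φ
  obtain ⟨C, hC⟩ : ∃ C, ∀ w, (1 + ‖w‖) ^ k * ‖ψ w‖ ≤ C := by
    have h := SchwartzMap.one_add_le_sup_seminorm_apply (𝕜 := ℝ) (m := (k, 0)) le_rfl le_rfl ψ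
    simp only [norm_iteratedFDeriv_zero] at h
    exact ⟨_, h⟩
  refine ⟨(2 * Real.pi) ^ k * max C 0, by positivity, fun p => ?_⟩
  have hω := energy_nonneg m p
  rw [← div_eq_mul_inv, le_div_iff₀ (by positivity), shellFourier_eq]
  calc ‖ψ (waveVector m p)‖ * (1 + energy m p) ^ k
      ≤ ‖ψ (waveVector m p)‖ * (2 * Real.pi * (1 + ‖waveVector m p‖)) ^ k := by
        gcongr; exact energy_le_norm_waveVector p
    _ = (2 * Real.pi) ^ k * ((1 + ‖waveVector m p‖) ^ k * ‖ψ (waveVector m p)‖) := by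
        rw [mul_pow]; ring
    _ ≤ _ := by
        gcongr
        exact (hC _).trans (le_max_left _ _)

theorem integrable_shellFourier (hF : Continuous F)
    (hb : ∀ p, ‖F p‖ ≤ C * (1 + energy m p) ^ N) (φ : 𝓢(Spacetime, ℂ)) :
    Integrable fun p => 1 / (2 * (energy m p : ℂ)) * F p * shellFourier m φ p := by
  -- Of the `N + 3` powers of decay, `N` cancel the growth of `F` and three make the integral
  -- converge.
  obtain ⟨K, hK, h⟩ := exists_norm_shellFourier_le m φ (N + 3)
  have h1 := (continuous_energy m).measurable
  have h2 := hF.measurable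
  have h3 := (continuous_shellFourier (m := m) φ).measurable
  refine ((integrable_inv_energy_mul_inv m).const_mul (C * K)).mono'
    (Measurable.aestronglyMeasurable (by fun_prop)) (.of_forall fun p => ?_)
  have hω := energy_nonneg m p
  rw [norm_mul, norm_mul, norm_div, norm_one, norm_mul, Complex.norm_real,
    Real.norm_of_nonneg hω, Complex.norm_ofNat, one_div]
  have hCN : 0 ≤ C * (1 + energy m p) ^ N := (norm_nonneg _).trans (hb p)
  calc _ ≤ (2 * energy m p)⁻¹ * (C * (1 + energy m p) ^ N) *
        (K * ((1 + energy m p) ^ (N + 3))⁻¹) := by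
        gcongr
        · exact hb p
        · exact h p
    _ = _ := by
        rw [pow_add, mul_inv]
        have : (1 + energy m p) ^ N ≠ 0 := by positivity
        field_simp

/-- The integrand over spacetime and momentum space at the complex time `y₀ - iε`. -/
theorem integrable_prod_shellIntegrand (hF : Continuous F)
    (hb : ∀ p, ‖F p‖ ≤ C * (1 + energy m p) ^ N) (φ : 𝓢(Spacetime, ℂ)) {ε : ℝ} (hε : 0 < ε) :
    Integrable (fun w : Spacetime × Space3 =>
      shellIntegrand m F ((w.1 0 : ℂ) - ε * Complex.I) (spatial w.1) w.2 * φ w.1)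
      (volume.prod volume) := by
  have h1 : Integrable fun p : Space3 => (2 * energy m p)⁻¹ *
      (‖F p‖ * Real.exp (-ε * energy m p)) := by
    have := (integrable_shellIntegrand (z := -ε * Complex.I) hF hb (by simpa using hε) 0).norm
    simpa [norm_shellIntegrand] using this
  have hm := (continuous_energy m).measurable
  have hFm := hF.measurable
  have hs := continuous_spatial.measurable
  have hφ := φ.continuous.measurable
  refine (φ.integrable.norm.mul_prod h1).mono' (Measurable.aestronglyMeasurable ?_)
    (.of_forall fun w => ?_)
  · unfold shellIntegrand; fun_prop
  · rw [norm_mul, norm_shellIntegrand]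
    simp [mul_comm]

/-- The imaginary shift of time separates as `exp(-ε ω_p)`; what remains of the phase is the Fourier
character defining `shellFourier`. -/
theorem integral_shellIntegrand_mul (φ : 𝓢(Spacetime, ℂ)) (ε : ℝ) (p : Space3) :
    ∫ y : Spacetime, shellIntegrand m F ((y 0 : ℂ) - ε * Complex.I) (spatial y) p * φ y =
      Complex.exp (-ε * energy m p) *
        (1 / (2 * (energy m p : ℂ)) * F p * shellFourier m φ p) := by
  rw [shellFourier, ← integral_const_mul, ← integral_const_mul]
  congr 1
  ext y
  have : -Complex.I * (((y 0 : ℂ) - ε * Complex.I) * (energy m p : ℂ) -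
      ((inner ℝ p (spatial y) : ℝ) : ℂ)) =
      -ε * energy m p + -Complex.I * (minkowski (energy m p) p y : ℂ) := by
    simp only [minkowski]
    push_cast
    linear_combination (ε * (energy m p : ℂ)) * Complex.I_sq
  rw [shellIntegrand, this, Complex.exp_add]
  ring

theorem integrable_shellIntegral_mul (hF : Continuous F)
    (hb : ∀ p, ‖F p‖ ≤ C * (1 + energy m p) ^ N) (φ : 𝓢(Spacetime, ℂ)) {ε : ℝ} (hε : 0 < ε) :
    Integrable fun y : Spacetime =>
      shellIntegral m F ((y 0 : ℂ) - ε * Complex.I) (spatial y) * φ y := by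
  have := (integrable_prod_shellIntegrand hF hb φ hε).integral_prod_left
  simpa only [integral_mul_const, shellIntegral] using this

theorem integral_shellIntegral_mul (hF : Continuous F)
    (hb : ∀ p, ‖F p‖ ≤ C * (1 + energy m p) ^ N) (φ : 𝓢(Spacetime, ℂ)) {ε : ℝ} (hε : 0 < ε) :
    ∫ y : Spacetime, shellIntegral m F ((y 0 : ℂ) - ε * Complex.I) (spatial y) * φ y =
      ∫ p : Space3, Complex.exp (-ε * energy m p) *
        (1 / (2 * (energy m p : ℂ)) * F p * shellFourier m φ p) := by
  simp_rw [← integral_shellIntegrand_mul, shellIntegral, ← integral_mul_const]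
  exact integral_integral_swap (integrable_prod_shellIntegrand hF hb φ hε)

theorem tendsto_integral_shellIntegral_mul (hF : Continuous F)
    (hb : ∀ p, ‖F p‖ ≤ C * (1 + energy m p) ^ N) (φ : 𝓢(Spacetime, ℂ)) :
    Tendsto (fun ε : ℝ => ∫ y : Spacetime,
        shellIntegral m F ((y 0 : ℂ) - ε * Complex.I) (spatial y) * φ y) (𝓝[>] 0)
      (𝓝 (∫ p : Space3, 1 / (2 * (energy m p : ℂ)) * F p * shellFourier m φ p)) := by
  have hint := integrable_shellFourier hF hb φ
  have hω := (continuous_energy m).measurable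
  have h : Tendsto (fun ε : ℝ => ∫ p : Space3, Complex.exp (-ε * energy m p) *
        (1 / (2 * (energy m p : ℂ)) * F p * shellFourier m φ p)) (𝓝[>] 0)
      (𝓝 (∫ p : Space3, 1 / (2 * (energy m p : ℂ)) * F p * shellFourier m φ p)) := by
    refine tendsto_integral_filter_of_dominated_convergence _ (.of_forall fun ε => ?_) ?_
      hint.norm (.of_forall fun p => ?_)
    · have : Measurable fun p => Complex.exp (-ε * energy m p) := by fun_prop
      exact this.aestronglyMeasurable.mul hint.1
    · filter_upwards [self_mem_nhdsWithin] with ε hε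
      refine .of_forall fun p => ?_
      rw [norm_mul]
      refine mul_le_of_le_one_left (norm_nonneg _) ?_
      have hε' : (0 : ℝ) < ε := hε
      rw [Complex.norm_exp, Real.exp_le_one_iff]
      have := mul_nonneg hε'.le (energy_nonneg m p)
      simpa using this
    · have hc : Continuous fun ε : ℝ => Complex.exp (-ε * energy m p) *
          (1 / (2 * (energy m p : ℂ)) * F p * shellFourier m φ p) := by fun_prop
      have := hc.tendsto 0
      simp only [Complex.ofReal_zero, neg_zero, zero_mul, Complex.exp_zero, one_mul] at this
      exact this.mono_left nhdsWithin_le_nhds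
  refine h.congr' ?_
  filter_upwards [self_mem_nhdsWithin] with ε hε
  exact (integral_shellIntegral_mul hF hb φ hε).symm

end MassShell

/-! ### A cutoff adapted to the ball of radius `R` -/

section Cutoff

variable {R : ℝ}

/-- A cutoff function that is `1` near the ball of radius `R` and supported in a slightly larger
ball. -/
def narrowBump (hR : 0 < R) : ContDiffBump (0 : Spacetime) where
  rIn := 11 / 10 * R
  rOut := 12 / 10 * R
  rIn_pos := by positivity
  rIn_lt_rOut := by linarith

/-- `narrowBump` as a test function. -/
def narrowCutoff (hR : 0 < R) : 𝓓((⊤ : Opens Spacetime), ℝ) where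
  toFun := narrowBump hR
  contDiff' := (narrowBump hR).contDiff
  hasCompactSupport' := (narrowBump hR).hasCompactSupport
  tsupport_subset' := fun _ _ => trivial

theorem norm_le_of_mem_tsupport_narrowCutoff (hR : 0 < R) {y : Spacetime}
    (hy : y ∈ tsupport (narrowCutoff hR)) : ‖y‖ ≤ 12 / 10 * R := by
  have h : tsupport (narrowBump hR) = Metric.closedBall 0 (12 / 10 * R) :=
    (narrowBump hR).tsupport_eq
  have hy' : y ∈ tsupport (narrowBump hR) := hy
  rw [h] at hy'
  simpa using hy'

/-- The support radius of the cutoff enters the decay rate below multiplied by `√2`, and the result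
must stay below `2R`. The radius `12/10 R` achieves this; the radius `|R| + 2` of `cutoff` need not.
-/
theorem fourierD_eq_narrow (hR : 0 < R) (f : 𝓓'((⊤ : Opens Spacetime), ℂ))
    (hf : Distribution.dsupport f ⊆ Metric.closedBall 0 R) (k₀ : ℝ) (k : Space3) :
    fourierD R f k₀ k = pairExp f (narrowCutoff hR) k₀ k := by
  refine fourierD_eq_pairExp R f hf _ (eventually_nhdsSet_iff_forall.2 fun y hy => ?_) k₀ k
  have hy' : dist y 0 < 11 / 10 * R := by
    have := Metric.mem_closedBall.1 (hf hy)
    linarith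
  exact (narrowBump hR).eventuallyEq_one_of_mem_ball hy'

end Cutoff

/-! ### Complex momenta as linear forms on spacetime -/

section WaveForms

/-- The time coordinate as a complex-valued linear form. -/
def timeForm : Spacetime →L[ℝ] ℂ :=
  Complex.ofRealCLM ∘L (EuclideanSpace.proj 0 : Spacetime →L[ℝ] ℝ)

/-- The spatial projection as a linear map. -/
def spatialCLM : Spacetime →L[ℝ] Space3 where
  toFun := spatial
  map_add' _ _ := rfl
  map_smul' _ _ := rfl
  cont := continuous_spatial

/-- The linear form `y ↦ p·y`. -/
def spaceForm : Space3 →L[ℝ] Spacetime →L[ℝ] ℂ :=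
  (ContinuousLinearMap.compL ℝ Spacetime ℝ ℂ Complex.ofRealCLM) ∘L
    ((ContinuousLinearMap.compL ℝ Spacetime Space3 ℝ).flip spatialCLM) ∘L innerSL ℝ

theorem timeForm_apply (y : Spacetime) : timeForm y = (y 0 : ℂ) := rfl

theorem spaceForm_apply (p : Space3) (y : Spacetime) :
    spaceForm p y = ((inner ℝ p (spatial y) : ℝ) : ℂ) := rfl

theorem norm_sq_eq_time_add_spatial (y : Spacetime) : ‖y‖ ^ 2 = y 0 ^ 2 + ‖spatial y‖ ^ 2 := by
  simp [EuclideanSpace.norm_sq_eq, Fin.sum_univ_succ, spatial]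

theorem norm_timeForm_le : ‖timeForm‖ ≤ 1 := by
  refine ContinuousLinearMap.opNorm_le_bound _ zero_le_one fun y => ?_
  rw [timeForm_apply, Complex.norm_real, one_mul]
  exact PiLp.norm_apply_le y 0

theorem norm_spatial_le (y : Spacetime) : ‖spatial y‖ ≤ ‖y‖ := by
  have h := norm_sq_eq_time_add_spatial y
  exact le_of_sq_le_sq (by nlinarith [sq_nonneg (y 0)]) (norm_nonneg _)

theorem norm_spaceForm_le (p : Space3) : ‖spaceForm p‖ ≤ ‖p‖ := by
  refine ContinuousLinearMap.opNorm_le_bound _ (norm_nonneg _) fun y => ?_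
  rw [spaceForm_apply, Complex.norm_real]
  exact (norm_inner_le_norm _ _).trans (by gcongr; exact norm_spatial_le y)

/-- The linear form `y ↦ i (σ κ y₀ - (p + c e)·y)` for complex `κ` and `c`. -/
def waveForm (σ : ℝ) (e : Space3) (κ : ℂ) (p : Space3) (c : ℂ) : Spacetime →L[ℝ] ℂ :=
  (Complex.I * σ * κ) • timeForm - Complex.I • (spaceForm p + c • spaceForm e)

theorem waveForm_apply (σ : ℝ) (e : Space3) (κ : ℂ) (p : Space3) (c : ℂ) (y : Spacetime) :
    waveForm σ e κ p c y = Complex.I * (σ * κ * y 0 -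
      (((inner ℝ p (spatial y) : ℝ) : ℂ) + c * ((inner ℝ e (spatial y) : ℝ) : ℂ))) := by
  simp only [waveForm, sub_apply, smul_apply,
    add_apply, timeForm_apply, spaceForm_apply, smul_eq_mul]
  ring

theorem norm_waveForm_le {σ : ℝ} (hσ : |σ| = 1) {e : Space3} (he : ‖e‖ ≤ 1) (κ : ℂ) (p : Space3)
    (c : ℂ) : ‖waveForm σ e κ p c‖ ≤ ‖κ‖ + ‖p‖ + ‖c‖ := by
  have h1 : ‖(Complex.I * σ * κ) • timeForm‖ ≤ ‖κ‖ := by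
    rw [norm_smul, norm_mul, norm_mul, Complex.norm_I, Complex.norm_real, Real.norm_eq_abs, hσ]
    nlinarith [norm_timeForm_le, norm_nonneg κ]
  have h2 : ‖Complex.I • (spaceForm p + c • spaceForm e)‖ ≤ ‖p‖ + ‖c‖ := by
    rw [norm_smul, Complex.norm_I, one_mul]
    refine (norm_add_le _ _).trans (add_le_add (norm_spaceForm_le p) ?_)
    rw [norm_smul]
    nlinarith [norm_spaceForm_le e, norm_nonneg c]
  have := norm_sub_le ((Complex.I * σ * κ) • timeForm)
    (Complex.I • (spaceForm p + c • spaceForm e))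
  rw [waveForm]
  linarith

theorem expPair_waveForm (f : 𝓓'((⊤ : Opens Spacetime), ℂ)) (χ : 𝓓((⊤ : Opens Spacetime), ℝ))
    (σ : ℝ) (e : Space3) (k₀ : ℝ) (p : Space3) :
    expPair f χ (waveForm σ e k₀ p 0) = pairExp f χ (σ * k₀) p := by
  have h : ∀ y, waveForm σ e k₀ p 0 y = ((minkowski (σ * k₀) p y : ℝ) : ℂ) * Complex.I := by
    intro y
    rw [waveForm_apply, minkowski]
    push_cast
    ring
  simp only [expPair, complexPair, pairExp, h, Complex.exp_ofReal_mul_I_re,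
    Complex.exp_ofReal_mul_I_im]

end WaveForms

/-! ### Imaginary boosts of the mass shell -/

section Rotation

/-- The energy component of the mass-shell momentum `(ω_p, p)` rotated by the imaginary boost
`i t` in the direction `e`. -/
def rotEnergy (m : ℝ) (e : Space3) (t : ℝ) (p : Space3) : ℂ :=
  (energy m p : ℂ) * Real.cos t + Complex.I * ((inner ℝ p e : ℝ) : ℂ) * Real.sin t

/-- The multiple of `e` that the imaginary boost `i t` in the direction `e` adds to `p`. -/
def rotShift (m : ℝ) (e : Space3) (t : ℝ) (p : Space3) : ℂ :=
  ((Real.cos t : ℂ) - 1) * ((inner ℝ p e : ℝ) : ℂ) + Complex.I * (energy m p : ℂ) * Real.sin t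

/-- The derivative of `rotEnergy` in `t`. -/
def rotEnergyDeriv (m : ℝ) (e : Space3) (t : ℝ) (p : Space3) : ℂ :=
  -(energy m p : ℂ) * Real.sin t + Complex.I * ((inner ℝ p e : ℝ) : ℂ) * Real.cos t

/-- The derivative of `rotShift` in `t`. -/
def rotShiftDeriv (m : ℝ) (e : Space3) (t : ℝ) (p : Space3) : ℂ :=
  -(Real.sin t : ℂ) * ((inner ℝ p e : ℝ) : ℂ) + Complex.I * (energy m p : ℂ) * Real.cos t

variable {m : ℝ} {e : Space3}

theorem abs_inner_le_energy (he : ‖e‖ ≤ 1) (p : Space3) :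
    |(inner ℝ p e : ℝ)| ≤ energy m p := by
  refine (abs_real_inner_le_norm p e).trans ?_
  have := norm_le_energy m p
  nlinarith [norm_nonneg p, norm_nonneg e]

theorem norm_ofReal_mul_add_le {a b c d E : ℝ} (ha : |a| ≤ E) (hb : |b| ≤ 1) (hc : |c| ≤ E)
    (hd : |d| ≤ 1) (u v : ℂ) (hu : ‖u‖ = 1) (hv : ‖v‖ = 1) :
    ‖u * (a * b : ℝ) + v * (c * d : ℝ)‖ ≤ 2 * E := by
  have hE : 0 ≤ E := (abs_nonneg a).trans ha
  refine (norm_add_le _ _).trans ?_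
  rw [norm_mul, norm_mul, hu, hv, Complex.norm_real, Complex.norm_real, norm_mul, norm_mul,
    Real.norm_eq_abs, Real.norm_eq_abs, Real.norm_eq_abs, Real.norm_eq_abs]
  have h1 := mul_le_mul ha hb (abs_nonneg b) hE
  have h2 := mul_le_mul hc hd (abs_nonneg d) hE
  linarith

theorem abs_energy_le (p : Space3) : |energy m p| ≤ energy m p :=
  (abs_of_nonneg (energy_nonneg m p)).le

theorem norm_rotEnergy_le (he : ‖e‖ ≤ 1) (t : ℝ) (p : Space3) :
    ‖rotEnergy m e t p‖ ≤ 2 * energy m p := by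
  have := norm_ofReal_mul_add_le (abs_energy_le (m := m) p) (Real.abs_cos_le_one t)
    (abs_inner_le_energy (m := m) he p) (Real.abs_sin_le_one t) 1 Complex.I (by simp) (by simp)
  convert this using 2
  rw [rotEnergy]; push_cast; ring

theorem norm_rotEnergyDeriv_le (he : ‖e‖ ≤ 1) (t : ℝ) (p : Space3) :
    ‖rotEnergyDeriv m e t p‖ ≤ 2 * energy m p := by
  have := norm_ofReal_mul_add_le (abs_energy_le (m := m) p) (Real.abs_sin_le_one t)
    (abs_inner_le_energy (m := m) he p) (Real.abs_cos_le_one t) (-1) Complex.I (by simp) (by simp)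
  convert this using 2
  rw [rotEnergyDeriv]; push_cast; ring

theorem norm_rotShiftDeriv_le (he : ‖e‖ ≤ 1) (t : ℝ) (p : Space3) :
    ‖rotShiftDeriv m e t p‖ ≤ 2 * energy m p := by
  have := norm_ofReal_mul_add_le (abs_inner_le_energy (m := m) he p) (Real.abs_sin_le_one t)
    (abs_energy_le (m := m) p) (Real.abs_cos_le_one t) (-1) Complex.I (by simp) (by simp)
  convert this using 2
  rw [rotShiftDeriv]; push_cast; ring

theorem norm_rotShift_le (he : ‖e‖ ≤ 1) (t : ℝ) (p : Space3) :
    ‖rotShift m e t p‖ ≤ 3 * energy m p := by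
  have h := norm_ofReal_mul_add_le (abs_inner_le_energy (m := m) he p) (Real.abs_cos_le_one t)
    (abs_energy_le (m := m) p) (Real.abs_sin_le_one t) 1 Complex.I (by simp) (by simp)
  have h2 : ‖((inner ℝ p e : ℝ) : ℂ)‖ ≤ energy m p := by
    rw [Complex.norm_real]; exact abs_inner_le_energy he p
  have h3 : rotShift m e t p = (1 * ((inner ℝ p e * Real.cos t : ℝ) : ℂ) +
      Complex.I * ((energy m p * Real.sin t : ℝ) : ℂ)) - ((inner ℝ p e : ℝ) : ℂ) := by
    rw [rotShift]; push_cast; ring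
  rw [h3]
  refine (norm_sub_le _ _).trans ?_
  linarith

theorem hasDerivAt_rotEnergy (t : ℝ) (p : Space3) :
    HasDerivAt (fun t => rotEnergy m e t p) (rotEnergyDeriv m e t p) t := by
  have h1 := (Real.hasDerivAt_cos t).ofReal_comp.const_mul (energy m p : ℂ)
  have h2 := (Real.hasDerivAt_sin t).ofReal_comp.const_mul
    (Complex.I * ((inner ℝ p e : ℝ) : ℂ))
  refine (h1.add h2).congr_deriv ?_
  rw [rotEnergyDeriv]; push_cast; ring

theorem hasDerivAt_rotShift (t : ℝ) (p : Space3) :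
    HasDerivAt (fun t => rotShift m e t p) (rotShiftDeriv m e t p) t := by
  have h1 := ((Real.hasDerivAt_cos t).ofReal_comp.sub_const 1).mul_const ((inner ℝ p e : ℝ) : ℂ)
  have h2 := (Real.hasDerivAt_sin t).ofReal_comp.const_mul (Complex.I * (energy m p : ℂ))
  refine (h1.add h2).congr_deriv ?_
  rw [rotShiftDeriv]; push_cast; ring

theorem energy_pos (hm : 0 < m) (p : Space3) : 0 < energy m p := hm.trans_le (le_energy m p)

theorem hasDerivAt_inner_add_smul (he : ‖e‖ = 1) (p : Space3) :
    HasDerivAt (fun s : ℝ => (inner ℝ (p + s • e) e : ℝ)) 1 0 := by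
  have h : ∀ s : ℝ, (inner ℝ (p + s • e) e : ℝ) = inner ℝ p e + s := fun s => by
    rw [inner_add_left, real_inner_smul_left, real_inner_self_eq_norm_sq, he]; ring
  simp_rw [h]
  exact (hasDerivAt_id 0).const_add _

theorem hasDerivAt_energy_add_smul (hm : 0 < m) (he : ‖e‖ = 1) (p : Space3) :
    HasDerivAt (fun s : ℝ => energy m (p + s • e)) (inner ℝ p e / energy m p) 0 := by
  have h : ∀ s : ℝ, ‖p + s • e‖ ^ 2 + m ^ 2 = ‖p‖ ^ 2 + 2 * s * inner ℝ p e + s ^ 2 + m ^ 2 := by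
    intro s
    rw [norm_add_sq_real, norm_smul, he, real_inner_smul_right, Real.norm_eq_abs, mul_one, sq_abs]
    ring
  have h1 : HasDerivAt (fun s : ℝ => ‖p‖ ^ 2 + 2 * s * inner ℝ p e + s ^ 2 + m ^ 2)
      (2 * inner ℝ p e) 0 := by
    have h2 := ((((hasDerivAt_id (0 : ℝ)).const_mul 2).mul_const (inner ℝ p e : ℝ)).const_add
      (‖p‖ ^ 2)).add (hasDerivAt_pow 2 (0 : ℝ))
    refine (h2.add_const (m ^ 2)).congr_deriv ?_
    simp
  have hpos : ‖p‖ ^ 2 + 2 * 0 * inner ℝ p e + 0 ^ 2 + m ^ 2 ≠ (0 : ℝ) := by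
    have : 0 < m ^ 2 := by positivity
    nlinarith [sq_nonneg ‖p‖]
  have h3 := h1.sqrt hpos
  simp only [energy, h]
  refine h3.congr_deriv ?_
  have : √(‖p‖ ^ 2 + 2 * 0 * inner ℝ p e + 0 ^ 2 + m ^ 2) = √(‖p‖ ^ 2 + m ^ 2) := by
    congr 1; ring
  rw [this, mul_div_mul_left _ _ two_ne_zero]

/-- Along `e`, the derivative of `p·e` is 1 and that of `ω_p` is `(p·e)/ω_p`. The vector field `ω_p
∂_e` thus generates boosts, and the rotation angle is an imaginary boost parameter. -/
theorem hasDerivAt_rotEnergy_add_smul (hm : 0 < m) (he : ‖e‖ = 1) (t : ℝ) (p : Space3) :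
    HasDerivAt (fun s : ℝ => rotEnergy m e t (p + s • e))
      (-(Complex.I / energy m p) * rotEnergyDeriv m e t p) 0 := by
  have hω : (energy m p : ℂ) ≠ 0 := by exact_mod_cast (energy_pos hm p).ne'
  have h1 := (hasDerivAt_energy_add_smul hm he p).ofReal_comp.mul_const (Real.cos t : ℂ)
  have h2 := ((hasDerivAt_inner_add_smul he p).ofReal_comp.const_mul Complex.I).mul_const
    (Real.sin t : ℂ)
  refine (h1.add h2).congr_deriv ?_
  rw [rotEnergyDeriv]
  push_cast
  field_simp
  linear_combination ((inner ℝ p e : ℝ) : ℂ) * Complex.cos t * Complex.I_sq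

/-- The term `-1` compensates the derivative `e` of `p` itself in `p + c e`; the two cancel in
`hasDerivAt_rotForm_add_smul`. -/
theorem hasDerivAt_rotShift_add_smul (hm : 0 < m) (he : ‖e‖ = 1) (t : ℝ) (p : Space3) :
    HasDerivAt (fun s : ℝ => rotShift m e t (p + s • e))
      (-(Complex.I / energy m p) * rotShiftDeriv m e t p - 1) 0 := by
  have hω : (energy m p : ℂ) ≠ 0 := by exact_mod_cast (energy_pos hm p).ne'
  have h1 := (hasDerivAt_inner_add_smul he p).ofReal_comp.const_mul ((Real.cos t : ℂ) - 1)
  have h2 := ((hasDerivAt_energy_add_smul hm he p).ofReal_comp.const_mul Complex.I).mul_const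
    (Real.sin t : ℂ)
  refine (h1.add h2).congr_deriv ?_
  rw [rotShiftDeriv]
  push_cast
  field_simp
  linear_combination (energy m p : ℂ) * Complex.cos t * Complex.I_sq

/-- The linear form `y ↦ i (σ k₀ y₀ - k·y)` at the rotated mass-shell momentum. -/
def rotForm (m σ : ℝ) (e : Space3) (t : ℝ) (p : Space3) : Spacetime →L[ℝ] ℂ :=
  waveForm σ e (rotEnergy m e t p) p (rotShift m e t p)

/-- The derivative of `rotForm` in `t`. -/
def rotFormDeriv (m σ : ℝ) (e : Space3) (t : ℝ) (p : Space3) : Spacetime →L[ℝ] ℂ :=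
  waveForm σ e (rotEnergyDeriv m e t p) 0 (rotShiftDeriv m e t p)

/-- The exponent `-u k₀ + i k·x` at the rotated mass-shell momentum. -/
def rotPhase (m : ℝ) (e : Space3) (u : ℝ) (x : Space3) (t : ℝ) (p : Space3) : ℂ :=
  -u * rotEnergy m e t p +
    Complex.I * (((inner ℝ p x : ℝ) : ℂ) + rotShift m e t p * ((inner ℝ e x : ℝ) : ℂ))

/-- The derivative of `rotPhase` in `t`. -/
def rotPhaseDeriv (m : ℝ) (e : Space3) (u : ℝ) (x : Space3) (t : ℝ) (p : Space3) : ℂ :=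
  -u * rotEnergyDeriv m e t p +
    Complex.I * (rotShiftDeriv m e t p * ((inner ℝ e x : ℝ) : ℂ))

variable {σ : ℝ}

theorem hasDerivAt_waveForm {κ c : ℝ → ℂ} {q : ℝ → Space3} {κ' c' : ℂ} {q' : Space3} {t : ℝ}
    (hκ : HasDerivAt κ κ' t) (hq : HasDerivAt q q' t) (hc : HasDerivAt c c' t) :
    HasDerivAt (fun t => waveForm σ e (κ t) (q t) (c t)) (waveForm σ e κ' q' c') t := by
  have h1 := (hκ.const_mul (Complex.I * σ)).smul_const timeForm
  have h2 := ((spaceForm.hasFDerivAt.comp_hasDerivAt t hq).add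
    (hc.smul_const (spaceForm e))).const_smul Complex.I
  exact h1.sub h2

theorem hasDerivAt_rotForm (t : ℝ) (p : Space3) :
    HasDerivAt (fun t => rotForm m σ e t p) (rotFormDeriv m σ e t p) t :=
  hasDerivAt_waveForm (hasDerivAt_rotEnergy t p) (hasDerivAt_const t p) (hasDerivAt_rotShift t p)

theorem hasDerivAt_add_smul (p : Space3) : HasDerivAt (fun s : ℝ => p + s • e) e 0 := by
  simpa using ((hasDerivAt_id (0 : ℝ)).smul_const e).const_add p

theorem hasDerivAt_rotForm_add_smul (hm : 0 < m) (he : ‖e‖ = 1) (t : ℝ) (p : Space3) :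
    HasDerivAt (fun s : ℝ => rotForm m σ e t (p + s • e))
      (-(Complex.I / energy m p) • rotFormDeriv m σ e t p) 0 := by
  refine (hasDerivAt_waveForm (hasDerivAt_rotEnergy_add_smul hm he t p) (hasDerivAt_add_smul p)
    (hasDerivAt_rotShift_add_smul hm he t p)).congr_deriv ?_
  ext y
  rw [rotFormDeriv, smul_apply, waveForm_apply, waveForm_apply, smul_eq_mul,
    inner_zero_left]
  push_cast
  ring

theorem hasDerivAt_rotPhase (u : ℝ) (x : Space3) (t : ℝ) (p : Space3) :
    HasDerivAt (fun t => rotPhase m e u x t p) (rotPhaseDeriv m e u x t p) t :=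
  ((hasDerivAt_rotEnergy t p).const_mul _).add
    ((((hasDerivAt_rotShift t p).mul_const _).const_add _).const_mul _)

theorem hasDerivAt_rotPhase_add_smul (hm : 0 < m) (he : ‖e‖ = 1) (u : ℝ) (x : Space3) (t : ℝ)
    (p : Space3) :
    HasDerivAt (fun s : ℝ => rotPhase m e u x t (p + s • e))
      (-(Complex.I / energy m p) * rotPhaseDeriv m e u x t p) 0 := by
  have h0 : HasDerivAt (fun s : ℝ => (inner ℝ (p + s • e) x : ℝ)) (inner ℝ e x) 0 := by
    simpa using (hasDerivAt_add_smul (e := e) p).inner ℝ (hasDerivAt_const (0 : ℝ) x)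
  refine (((hasDerivAt_rotEnergy_add_smul hm he t p).const_mul _).add
    ((h0.ofReal_comp.add ((hasDerivAt_rotShift_add_smul hm he t p).mul_const _)).const_mul
      _)).congr_deriv ?_
  rw [rotPhaseDeriv]
  ring

theorem norm_rotForm_le (hσ : |σ| = 1) (he : ‖e‖ ≤ 1) (t : ℝ) (p : Space3) :
    ‖rotForm m σ e t p‖ ≤ 6 * energy m p := by
  have h := norm_waveForm_le hσ he (rotEnergy m e t p) p (rotShift m e t p)
  have h1 := norm_rotEnergy_le (m := m) he t p
  have h2 := norm_rotShift_le (m := m) he t p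
  have h3 := norm_le_energy m p
  rw [rotForm]; linarith

theorem norm_rotFormDeriv_le (hσ : |σ| = 1) (he : ‖e‖ ≤ 1) (t : ℝ) (p : Space3) :
    ‖rotFormDeriv m σ e t p‖ ≤ 4 * energy m p := by
  have h := norm_waveForm_le hσ he (rotEnergyDeriv m e t p) 0 (rotShiftDeriv m e t p)
  have h1 := norm_rotEnergyDeriv_le (m := m) he t p
  have h2 := norm_rotShiftDeriv_le (m := m) he t p
  rw [norm_zero] at h
  rw [rotFormDeriv]; linarith

theorem norm_rotPhaseDeriv_le (he : ‖e‖ ≤ 1) (u : ℝ) (x : Space3) (t : ℝ) (p : Space3) :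
    ‖rotPhaseDeriv m e u x t p‖ ≤ 2 * (|u| + ‖x‖) * energy m p := by
  have h1 := norm_rotEnergyDeriv_le (m := m) he t p
  have h2 := norm_rotShiftDeriv_le (m := m) he t p
  have h3 : ‖((inner ℝ e x : ℝ) : ℂ)‖ ≤ ‖x‖ := by
    rw [Complex.norm_real]
    exact (norm_inner_le_norm e x).trans (mul_le_of_le_one_left (norm_nonneg _) he)
  rw [rotPhaseDeriv]
  refine (norm_add_le _ _).trans ?_
  rw [norm_mul, norm_mul, norm_mul, norm_neg, Complex.norm_I, Complex.norm_real, one_mul,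
    Real.norm_eq_abs]
  have h4 := mul_le_mul_of_nonneg_left h1 (abs_nonneg u)
  have h5 := mul_le_mul h2 h3 (norm_nonneg _) (by have := energy_nonneg m p; positivity)
  linarith

theorem re_rotPhase (u : ℝ) (x : Space3) (t : ℝ) (p : Space3) :
    (rotPhase m e u x t p).re =
      -(energy m p * (u * Real.cos t + inner ℝ e x * Real.sin t)) := by
  simp [rotPhase, rotEnergy, rotShift, -Complex.ofReal_cos, -Complex.ofReal_sin]
  ring

theorem re_rotForm_le (hσ : |σ| = 1) (he : ‖e‖ ≤ 1) (t : ℝ) (p : Space3) {R : ℝ} {y : Spacetime}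
    (hR : 0 < R) (hy : ‖y‖ ≤ 12 / 10 * R) :
    (rotForm m σ e t p y).re ≤ energy m p * (17 / 10 * R * |Real.sin t|) := by
  have h : (rotForm m σ e t p y).re =
      -σ * inner ℝ p e * Real.sin t * y 0 + energy m p * Real.sin t * inner ℝ e (spatial y) := by
    simp [rotForm, waveForm_apply, rotEnergy, rotShift, -Complex.ofReal_cos,
      -Complex.ofReal_sin]
    ring
  have h1 : -σ * inner ℝ p e * Real.sin t * y 0 ≤ energy m p * |Real.sin t| * |y 0| := by
    refine (le_abs_self _).trans ?_
    rw [abs_mul, abs_mul, abs_mul, abs_neg, hσ, one_mul]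
    gcongr
    exact abs_inner_le_energy he p
  have h2 : energy m p * Real.sin t * inner ℝ e (spatial y) ≤
      energy m p * |Real.sin t| * ‖spatial y‖ := by
    refine (le_abs_self _).trans ?_
    rw [abs_mul, abs_mul, abs_of_nonneg (energy_nonneg m p)]
    have := energy_nonneg m p
    gcongr
    exact (abs_real_inner_le_norm e _).trans (mul_le_of_le_one_left (norm_nonneg _) he)
  -- By Cauchy–Schwarz the sum is at most `√2 ‖y‖`, and `√2 · 12/10 < 17/10`.
  have h3 : |y 0| + ‖spatial y‖ ≤ 17 / 10 * R := by
    have h4 := norm_sq_eq_time_add_spatial y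
    rw [← sq_abs (y 0)] at h4
    refine le_of_sq_le_sq ?_ (by positivity)
    nlinarith [sq_nonneg (|y 0| - ‖spatial y‖), norm_nonneg y]
  have h5 := mul_le_mul_of_nonneg_left h3
    (mul_nonneg (energy_nonneg m p) (abs_nonneg (Real.sin t)))
  rw [h]
  linarith

theorem continuous_rotForm : Continuous fun w : Space3 × ℝ => rotForm m σ e w.2 w.1 := by
  have := continuous_energy m
  unfold rotForm waveForm rotEnergy rotShift
  fun_prop

theorem continuous_rotPhase (u : ℝ) (x : Space3) :
    Continuous fun w : Space3 × ℝ => rotPhase m e u x w.2 w.1 := by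
  have := continuous_energy m
  unfold rotPhase rotEnergy rotShift
  fun_prop

end Rotation

/-! ### Contour rotation and exponential decay -/

section RotatedIntegral

variable {m σ R : ℝ} {e : Space3} {G : (Spacetime →L[ℝ] ℂ) → ℂ}
  {D : (Spacetime →L[ℝ] ℂ) → (Spacetime →L[ℝ] ℂ) →L[ℂ] ℂ} {C : ℝ} {N : ℕ}

/-- `exp(-u k₀ + i k·x) G(k)` at the rotated mass-shell momentum `k`. -/
def rotIntegrand (m σ : ℝ) (G : (Spacetime →L[ℝ] ℂ) → ℂ) (e : Space3) (u : ℝ) (x : Space3)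
    (t : ℝ) (p : Space3) : ℂ :=
  Complex.exp (rotPhase m e u x t p) * G (rotForm m σ e t p)

/-- The derivative of `rotIntegrand` in `t`. -/
def rotIntegrandDeriv (m σ : ℝ) (G : (Spacetime →L[ℝ] ℂ) → ℂ)
    (D : (Spacetime →L[ℝ] ℂ) → (Spacetime →L[ℝ] ℂ) →L[ℂ] ℂ) (e : Space3) (u : ℝ) (x : Space3)
    (t : ℝ) (p : Space3) : ℂ :=
  Complex.exp (rotPhase m e u x t p) * (rotPhaseDeriv m e u x t p * G (rotForm m σ e t p) +
    D (rotForm m σ e t p) (rotFormDeriv m σ e t p))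

theorem hasDerivAt_cexp_mul_comp {a : ℝ → ℂ} {l : ℝ → Spacetime →L[ℝ] ℂ} {a' : ℂ}
    {l' : Spacetime →L[ℝ] ℂ} {t : ℝ} (hG : HasFDerivAt G (D (l t)) (l t))
    (ha : HasDerivAt a a' t) (hl : HasDerivAt l l' t) :
    HasDerivAt (fun t => Complex.exp (a t) * G (l t))
      (Complex.exp (a t) * (a' * G (l t) + D (l t) l')) t := by
  have h := ha.cexp.mul ((hG.restrictScalars ℝ).comp_hasDerivAt t hl)
  refine h.congr_deriv ?_
  simp only [ContinuousLinearMap.coe_restrictScalars', Function.comp_apply]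
  ring

theorem hasDerivAt_rotIntegrand (hG : ∀ l, HasFDerivAt G (D l) l) (u : ℝ) (x : Space3) (t : ℝ)
    (p : Space3) :
    HasDerivAt (fun t => rotIntegrand m σ G e u x t p) (rotIntegrandDeriv m σ G D e u x t p) t :=
  hasDerivAt_cexp_mul_comp (hG _) (hasDerivAt_rotPhase u x t p) (hasDerivAt_rotForm t p)

/-- The derivative in the direction `e` is a multiple of the derivative in `t`. -/
theorem hasLineDerivAt_rotIntegrand (hG : ∀ l, HasFDerivAt G (D l) l) (hm : 0 < m)
    (he : ‖e‖ = 1) (u : ℝ) (x : Space3) (t : ℝ) (p : Space3) :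
    HasLineDerivAt ℝ (rotIntegrand m σ G e u x t)
      (-(Complex.I / energy m p) * rotIntegrandDeriv m σ G D e u x t p) p e := by
  have h := hasDerivAt_cexp_mul_comp (G := G) (D := D) (hG (rotForm m σ e t (p + (0 : ℝ) • e)))
    (hasDerivAt_rotPhase_add_smul hm he u x t p) (hasDerivAt_rotForm_add_smul hm he t p)
  refine HasDerivAt.congr_deriv (f := fun s : ℝ => rotIntegrand m σ G e u x t (p + s • e)) h ?_
  rw [zero_smul, add_zero, rotIntegrandDeriv, map_smul, smul_eq_mul]
  ring

/-- The exponential decay rate of the rotated integrand. -/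
def rotDecay (R : ℝ) (e : Space3) (u : ℝ) (x : Space3) (t : ℝ) : ℝ :=
  u * Real.cos t + inner ℝ e x * Real.sin t - 17 / 10 * R * |Real.sin t|

/-- The bound satisfied by the Fourier–Laplace transform of a distribution supported in the ball
of radius `12 / 10 * R`, and by its derivative. -/
def PaleyWienerBound (R C : ℝ) (N : ℕ) (G : (Spacetime →L[ℝ] ℂ) → ℂ)
    (D : (Spacetime →L[ℝ] ℂ) → (Spacetime →L[ℝ] ℂ) →L[ℂ] ℂ) : Prop :=
  ∀ l (s : ℝ), (∀ y : Spacetime, ‖y‖ ≤ 12 / 10 * R → (l y).re ≤ s) →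
    ‖G l‖ ≤ C * ((1 + ‖l‖) ^ N * Real.exp s) ∧ ‖D l‖ ≤ C * ((1 + ‖l‖) ^ N * Real.exp s)

theorem PaleyWienerBound.rotForm_le (hb : PaleyWienerBound R C N G D) (hC : 0 ≤ C) (hR : 0 < R)
    (hσ : |σ| = 1) (he : ‖e‖ ≤ 1) (t : ℝ) (p : Space3) :
    ‖G (rotForm m σ e t p)‖ ≤ C * 6 ^ N * ((1 + energy m p) ^ N *
        Real.exp (energy m p * (17 / 10 * R * |Real.sin t|))) ∧
      ‖D (rotForm m σ e t p)‖ ≤ C * 6 ^ N * ((1 + energy m p) ^ N *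
        Real.exp (energy m p * (17 / 10 * R * |Real.sin t|))) := by
  have h := hb (rotForm m σ e t p) _ fun y hy => re_rotForm_le hσ he t p hR hy
  have h1 : (1 + ‖rotForm m σ e t p‖) ^ N ≤ 6 ^ N * (1 + energy m p) ^ N := by
    rw [← mul_pow]
    gcongr
    linarith [norm_rotForm_le (m := m) hσ he t p]
  have h2 : C * ((1 + ‖rotForm m σ e t p‖) ^ N *
      Real.exp (energy m p * (17 / 10 * R * |Real.sin t|))) ≤ C * 6 ^ N * ((1 + energy m p) ^ N *
        Real.exp (energy m p * (17 / 10 * R * |Real.sin t|))) := by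
    calc _ ≤ C * ((6 ^ N * (1 + energy m p) ^ N) *
          Real.exp (energy m p * (17 / 10 * R * |Real.sin t|))) := by gcongr
      _ = _ := by ring
  exact ⟨h.1.trans h2, h.2.trans h2⟩

theorem exp_rotPhase_mul_exp (u : ℝ) (x : Space3) (t : ℝ) (p : Space3) :
    ‖Complex.exp (rotPhase m e u x t p)‖ * Real.exp (energy m p * (17 / 10 * R * |Real.sin t|)) =
      Real.exp (-rotDecay R e u x t * energy m p) := by
  rw [Complex.norm_exp, re_rotPhase, ← Real.exp_add, rotDecay]
  ring_nf

theorem norm_rotIntegrand_le (hb : PaleyWienerBound R C N G D) (hC : 0 ≤ C) (hR : 0 < R)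
    (hσ : |σ| = 1) (he : ‖e‖ ≤ 1) (u : ℝ) (x : Space3) (t : ℝ) (p : Space3) :
    ‖rotIntegrand m σ G e u x t p‖ ≤
      C * 6 ^ N * ((1 + energy m p) ^ N * Real.exp (-rotDecay R e u x t * energy m p)) := by
  rw [rotIntegrand, norm_mul, ← exp_rotPhase_mul_exp]
  calc _ ≤ ‖Complex.exp (rotPhase m e u x t p)‖ * (C * 6 ^ N * ((1 + energy m p) ^ N *
        Real.exp (energy m p * (17 / 10 * R * |Real.sin t|)))) := by
        gcongr; exact (hb.rotForm_le hC hR hσ he t p).1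
    _ = _ := by ring

theorem norm_rotIntegrandDeriv_le (hb : PaleyWienerBound R C N G D) (hC : 0 ≤ C) (hR : 0 < R)
    (hσ : |σ| = 1) (he : ‖e‖ ≤ 1) (u : ℝ) (x : Space3) (t : ℝ) (p : Space3) :
    ‖rotIntegrandDeriv m σ G D e u x t p‖ ≤
      C * 6 ^ N * (2 * (|u| + ‖x‖) + 4) * energy m p * ((1 + energy m p) ^ N *
        Real.exp (-rotDecay R e u x t * energy m p)) := by
  have hω := energy_nonneg m p
  obtain ⟨hG, hD⟩ := hb.rotForm_le (m := m) hC hR hσ he t p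
  rw [rotIntegrandDeriv, norm_mul, ← exp_rotPhase_mul_exp]
  set B := C * 6 ^ N * ((1 + energy m p) ^ N *
    Real.exp (energy m p * (17 / 10 * R * |Real.sin t|))) with hB
  calc _ ≤ ‖Complex.exp (rotPhase m e u x t p)‖ *
        (2 * (|u| + ‖x‖) * energy m p * B + B * (4 * energy m p)) := by
        gcongr
        refine (norm_add_le _ _).trans (add_le_add ?_ ?_)
        · rw [norm_mul]
          gcongr
          exact norm_rotPhaseDeriv_le he u x t p
        · refine (ContinuousLinearMap.le_opNorm _ _).trans ?_
          gcongr
          exact norm_rotFormDeriv_le hσ he t p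
    _ = _ := by rw [hB]; ring

theorem continuous_rotIntegrand (hG : ∀ l, HasFDerivAt G (D l) l) (u : ℝ) (x : Space3) :
    Continuous fun w : Space3 × ℝ => rotIntegrand m σ G e u x w.2 w.1 := by
  have h : Continuous G := continuous_iff_continuousAt.2 fun l => (hG l).continuousAt
  exact (Complex.continuous_exp.comp (continuous_rotPhase u x)).mul (h.comp continuous_rotForm)

theorem continuous_rotIntegrand_apply (hG : ∀ l, HasFDerivAt G (D l) l) (u : ℝ) (x : Space3)
    (t : ℝ) : Continuous (rotIntegrand m σ G e u x t) := by
  have h : Continuous fun p : Space3 => (p, t) := by fun_prop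
  have h2 := (continuous_rotIntegrand (m := m) (σ := σ) (e := e) hG u x).comp h
  rw [Function.comp_def] at h2
  exact h2

/-- Continuity of `D` is not assumed. Measurability comes from the function being the `t`-derivative
of a jointly continuous integrand. -/
theorem measurable_rotIntegrandDeriv (hG : ∀ l, HasFDerivAt G (D l) l) (u : ℝ) (x : Space3)
    (t : ℝ) : Measurable (rotIntegrandDeriv m σ G D e u x t) := by
  have h := (measurable_deriv_with_param (f := fun (p : Space3) (t : ℝ) =>
    rotIntegrand m σ G e u x t p) (continuous_rotIntegrand hG u x)).comp
    (measurable_prodMk_right (y := t))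
  have heq : rotIntegrandDeriv m σ G D e u x t =
      fun p => deriv (fun t => rotIntegrand m σ G e u x t p) t :=
    funext fun p => (hasDerivAt_rotIntegrand hG u x t p).deriv.symm
  rw [heq]
  exact h

/-- The mass-shell integral over the rotated momenta. -/
def rotIntegral (m σ : ℝ) (G : (Spacetime →L[ℝ] ℂ) → ℂ) (e : Space3) (u : ℝ) (x : Space3)
    (t : ℝ) : ℂ :=
  ∫ p : Space3, ((2 * energy m p)⁻¹ : ℝ) * rotIntegrand m σ G e u x t p

theorem integrable_rotIntegrand (hG : ∀ l, HasFDerivAt G (D l) l)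
    (hb : PaleyWienerBound R C N G D) (hC : 0 ≤ C) (hR : 0 < R)
    (hσ : |σ| = 1) (he : ‖e‖ ≤ 1) {u : ℝ} {x : Space3} {t : ℝ} (ht : 0 < rotDecay R e u x t) :
    Integrable fun p : Space3 => ((2 * energy m p)⁻¹ : ℝ) * rotIntegrand m σ G e u x t p := by
  have hω := (continuous_energy m).measurable
  have hm : Measurable fun p : Space3 => rotIntegrand m σ G e u x t p :=
    (continuous_rotIntegrand_apply hG u x t).measurable
  refine ((integrable_shell_weight m N ht).const_mul (C * 6 ^ N)).mono'
    (Measurable.aestronglyMeasurable (by fun_prop)) (.of_forall fun p => ?_)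
  have hω0 := energy_nonneg m p
  rw [norm_mul, Complex.norm_real, Real.norm_of_nonneg (by positivity)]
  calc _ ≤ (2 * energy m p)⁻¹ * (C * 6 ^ N * ((1 + energy m p) ^ N *
        Real.exp (-rotDecay R e u x t * energy m p))) := by
        gcongr; exact norm_rotIntegrand_le hb hC hR hσ he u x t p
    _ = _ := by ring

/-- Away from `w = 0`, the factor `1/(2w)` of the mass-shell weight can be inserted at the price of
one more power of `1 + w`. This yields integrability of the rotated integrand without that factor,
as integration by parts requires. -/
theorem mul_pow_mul_le_of_pos {A E w : ℝ} (hA : 0 ≤ A) (hw : 0 < w) (N : ℕ) (hE : 0 ≤ E) :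
    A * ((1 + w) ^ N * E) ≤ 2 * A * ((2 * w)⁻¹ * ((1 + w) ^ (N + 1) * E)) := by
  calc A * ((1 + w) ^ N * E) ≤ A * ((1 + w) ^ N * E) * ((1 + w) / w) := by
        refine le_mul_of_one_le_right (by positivity) ?_
        rw [one_le_div hw]; linarith
    _ = _ := by rw [mul_inv]; ring

theorem integrable_rotIntegrand_of_pos (hG : ∀ l, HasFDerivAt G (D l) l)
    (hb : PaleyWienerBound R C N G D) (hC : 0 ≤ C) (hR : 0 < R)
    (hσ : |σ| = 1) (hm : 0 < m) (he : ‖e‖ ≤ 1) {u : ℝ} {x : Space3} {t : ℝ}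
    (ht : 0 < rotDecay R e u x t) : Integrable (rotIntegrand m σ G e u x t) := by
  have h1 := (integrable_shell_weight m (N + 1) ht).const_mul (2 * (C * 6 ^ N))
  refine h1.mono' (continuous_rotIntegrand_apply hG u x t).aestronglyMeasurable (.of_forall fun p => ?_)
  refine (norm_rotIntegrand_le hb hC hR hσ he u x t p).trans ?_
  exact mul_pow_mul_le_of_pos (by positivity) (energy_pos hm p) N (Real.exp_pos _).le

theorem inv_energy_mul_rotIntegrandDeriv (hm : 0 < m) (u : ℝ) (x : Space3) (t : ℝ) (p : Space3) :
    (((2 * energy m p)⁻¹ : ℝ) : ℂ) * rotIntegrandDeriv m σ G D e u x t p =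
      (Complex.I / 2) * (-(Complex.I / energy m p) * rotIntegrandDeriv m σ G D e u x t p) := by
  have hω0 : (energy m p : ℂ) ≠ 0 := by exact_mod_cast (energy_pos hm p).ne'
  generalize rotIntegrandDeriv m σ G D e u x t p = w
  push_cast
  field_simp
  linear_combination w * Complex.I_sq

/-- The integral of a derivative in the direction `e` vanishes. -/
theorem integral_rotIntegrandDeriv_eq_zero (hG : ∀ l, HasFDerivAt G (D l) l) (hm : 0 < m)
    (he : ‖e‖ = 1) {u : ℝ} {x : Space3} {t : ℝ}
    (h0 : Integrable (rotIntegrand m σ G e u x t))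
    (h1 : Integrable fun p : Space3 =>
      (((2 * energy m p)⁻¹ : ℝ) : ℂ) * rotIntegrandDeriv m σ G D e u x t p) :
    ∫ p : Space3, (((2 * energy m p)⁻¹ : ℝ) : ℂ) * rotIntegrandDeriv m σ G D e u x t p = 0 := by
  simp only [inv_energy_mul_rotIntegrandDeriv hm] at h1 ⊢
  rw [integral_const_mul]
  have h2 : Integrable fun p : Space3 =>
      -(Complex.I / energy m p) * rotIntegrandDeriv m σ G D e u x t p :=
    (integrable_const_mul_iff (by simp) _).1 h1
  -- Integration by parts against the constant function 1.
  have h3 := integral_bilinear_hasLineDerivAt_right_eq_neg_left_of_integrable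
    (μ := (volume : Measure Space3)) (B := ContinuousLinearMap.mul ℝ ℂ)
    (f := fun _ : Space3 => (1 : ℂ)) (f' := fun _ => 0) (g := rotIntegrand m σ G e u x t)
    (g' := fun p => -(Complex.I / energy m p) * rotIntegrandDeriv m σ G D e u x t p) (v := e)
    (by simp) (by simpa using h2) (by simpa using h0)
    (fun p _ => hasDerivAt_const (0 : ℝ) (1 : ℂ))
    (fun p _ => hasLineDerivAt_rotIntegrand hG hm he u x t p)
  simp only [ContinuousLinearMap.mul_apply', one_mul, zero_mul, integral_zero, neg_zero] at h3
  rw [h3, mul_zero]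

/-- The rotated integral does not depend on the angle as long as the integrand decays. -/
theorem hasDerivAt_rotIntegral (hG : ∀ l, HasFDerivAt G (D l) l)
    (hb : PaleyWienerBound R C N G D) (hC : 0 ≤ C) (hR : 0 < R)
    (hσ : |σ| = 1) (hm : 0 < m) (he : ‖e‖ = 1) {u : ℝ} {x : Space3} {t : ℝ}
    (ht : 0 < rotDecay R e u x t) :
    HasDerivAt (rotIntegral m σ G e u x) 0 t := by
  have hω := (continuous_energy m).measurable
  have hdm := measurable_rotIntegrandDeriv (m := m) (σ := σ) (e := e) hG u x t
  set K := C * 6 ^ N * (2 * (|u| + ‖x‖) + 4) with hK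
  have hK0 : 0 ≤ K := by positivity
  have hcont : Continuous (rotDecay R e u x) := by unfold rotDecay; fun_prop
  -- Near `t` the decay rate exceeds half its value at `t`, so a single weight dominates the
  -- derivatives for all nearby angles.
  have hs : {s | rotDecay R e u x t / 2 < rotDecay R e u x s} ∈ 𝓝 t :=
    (isOpen_lt continuous_const hcont).mem_nhds
      (show rotDecay R e u x t / 2 < rotDecay R e u x t by linarith)
  have hbd : ∀ p : Space3, ∀ s ∈ {s | rotDecay R e u x t / 2 < rotDecay R e u x s},
      ‖rotIntegrandDeriv m σ G D e u x s p‖ ≤ K * energy m p * ((1 + energy m p) ^ N *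
        Real.exp (-(rotDecay R e u x t / 2) * energy m p)) := by
    intro p s hs
    have hω0 := energy_nonneg m p
    refine (norm_rotIntegrandDeriv_le hb hC hR hσ he.le u x s p).trans ?_
    gcongr
    exact le_of_lt hs
  have hwt := (integrable_shell_weight m (N + 1) (half_pos ht)).const_mul K
  have h := (hasDerivAt_integral_of_dominated_loc_of_deriv_le (μ := (volume : Measure Space3))
    (F := fun s p => ((2 * energy m p)⁻¹ : ℝ) * rotIntegrand m σ G e u x s p)
    (F' := fun s p => ((2 * energy m p)⁻¹ : ℝ) * rotIntegrandDeriv m σ G D e u x s p)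
    (bound := fun p => K * ((2 * energy m p)⁻¹ * ((1 + energy m p) ^ (N + 1) *
      Real.exp (-(rotDecay R e u x t / 2) * energy m p)))) hs
    (.of_forall fun s => ?_) (integrable_rotIntegrand hG hb hC hR hσ he.le ht)
    (Measurable.aestronglyMeasurable (by fun_prop)) (.of_forall fun p s hs => ?_) hwt
    (.of_forall fun p s _ => (hasDerivAt_rotIntegrand hG u x s p).const_mul _))
  · refine h.2.congr_deriv ?_
    exact integral_rotIntegrandDeriv_eq_zero hG hm he
      (integrable_rotIntegrand_of_pos hG hb hC hR hσ hm he.le ht) h.1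
  · have hms : Measurable fun p : Space3 => rotIntegrand m σ G e u x s p :=
      (continuous_rotIntegrand_apply hG u x s).measurable
    exact Measurable.aestronglyMeasurable (by fun_prop)
  · have hω0 := energy_nonneg m p
    rw [norm_mul, Complex.norm_real, Real.norm_of_nonneg (by positivity)]
    calc _ ≤ (2 * energy m p)⁻¹ * (K * (1 + energy m p) * ((1 + energy m p) ^ N *
          Real.exp (-(rotDecay R e u x t / 2) * energy m p))) := by
          gcongr
          refine (hbd p s hs).trans ?_
          gcongr
          linarith
      _ = _ := by ring

/-- Rotating by the angle of `(u, ‖x‖)` turns `exp(-u ω_p + i p·x)` into `exp(-r ω_p)`. -/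
theorem exists_norm_rotIntegral_zero_le (hG : ∀ l, HasFDerivAt G (D l) l)
    (hb : PaleyWienerBound R C N G D) (hC : 0 ≤ C) (hR : 0 < R) (hσ : |σ| = 1) (hm : 0 < m) :
    ∃ c : ℝ, 0 ≤ c ∧ ∀ (u : ℝ) (x : Space3), 0 < u → 2 * R ≤ √(u ^ 2 + ‖x‖ ^ 2) →
      ∃ e : Space3, ‖rotIntegral m σ G e u x 0‖ ≤ c * Real.exp (-m * √(u ^ 2 + ‖x‖ ^ 2)) := by
  set W : Space3 → ℝ := fun p => (2 * energy m p)⁻¹ *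
    ((1 + energy m p) ^ N * Real.exp (-(3 / 10 * R) * energy m p)) with hW
  have hWi : Integrable W := integrable_shell_weight m N (by positivity)
  have hW0 : ∀ p, 0 ≤ W p := fun p => by
    have := energy_nonneg m p
    positivity
  refine ⟨C * 6 ^ N * Real.exp (2 * R * m) * ∫ p, W p,
    mul_nonneg (by positivity) (integral_nonneg hW0), fun u x hu hr => ?_⟩
  -- The boost direction is that of `x`. For `x = 0` any unit vector serves, since the angle of
  -- rotation is then zero.
  obtain ⟨e, he, hex⟩ : ∃ e : Space3, ‖e‖ = 1 ∧ inner ℝ e x = ‖x‖ := by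
    rcases eq_or_ne x 0 with rfl | hx
    · exact ⟨EuclideanSpace.single 0 1, by simp, by simp⟩
    · have hx' : ‖x‖ ≠ 0 := norm_ne_zero_iff.2 hx
      refine ⟨‖x‖⁻¹ • x, by rw [norm_smul, norm_inv, norm_norm, inv_mul_cancel₀ hx'], ?_⟩
      rw [real_inner_smul_left, real_inner_self_eq_norm_sq]
      field_simp
  refine ⟨e, ?_⟩
  set r := √(u ^ 2 + ‖x‖ ^ 2) with hrdef
  have hr0 : 0 < r := by linarith
  set z : ℂ := ⟨u, ‖x‖⟩ with hz
  have hzr : ‖z‖ = r := by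
    rw [Complex.norm_def, Complex.normSq_mk, hrdef]; congr 1; ring
  set θ := z.arg with hθ
  have hcos : u = r * Real.cos θ := by
    rw [← hzr, Complex.norm_mul_cos_arg]
  have hsin : ‖x‖ = r * Real.sin θ := by
    rw [← hzr, Complex.norm_mul_sin_arg]
  have hθ0 : 0 ≤ θ := Complex.arg_nonneg_iff.2 (norm_nonneg x)
  have hθ1 : θ < Real.pi / 2 := by
    have := Complex.abs_arg_lt_pi_div_two_iff.2 (Or.inl (show 0 < z.re from hu))
    exact (le_abs_self _).trans_lt this
  have hdecay : ∀ t, rotDecay R e u x t = r * Real.cos (θ - t) - 17 / 10 * R * |Real.sin t| := by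
    intro t
    rw [rotDecay, hex, Real.cos_sub]
    linear_combination Real.cos t * hcos + Real.sin t * hsin
  -- As `θ ≤ π/2`, one has `θ - t ≤ π/2 - t` and hence `sin t ≤ cos(θ - t)`. The rate is therefore
  -- at least `(r - 17/10 R) cos(θ - t)`, which is positive because `r ≥ 2R`.
  have hpos : ∀ t ∈ Icc 0 θ, 0 < rotDecay R e u x t := by
    intro t ht
    have ht' : t ≤ Real.pi / 2 := ht.2.trans hθ1.le
    have h1 : Real.sin t ≤ Real.cos (θ - t) := by
      rw [← Real.cos_pi_div_two_sub, ← Real.cos_abs (θ - t), abs_of_nonneg (by linarith [ht.2])]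
      exact Real.cos_le_cos_of_nonneg_of_le_pi (by linarith [ht.2])
        (by linarith [ht.1, Real.pi_pos]) (by linarith)
    have h2 : 0 < Real.cos (θ - t) :=
      Real.cos_pos_of_mem_Ioo ⟨by linarith [ht.2, Real.pi_pos], by linarith [ht.1]⟩
    have h3 : 0 ≤ Real.sin t :=
      Real.sin_nonneg_of_nonneg_of_le_pi ht.1 (by linarith [Real.pi_pos])
    rw [hdecay, abs_of_nonneg h3]
    nlinarith
  have hconst := constant_of_has_deriv_right_zero (f := rotIntegral m σ G e u x) (a := 0) (b := θ)
    (fun t ht => (hasDerivAt_rotIntegral hG hb hC hR hσ hm he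
      (hpos t ht)).continuousAt.continuousWithinAt)
    (fun t ht => (hasDerivAt_rotIntegral hG hb hC hR hσ hm he
      (hpos t (Ico_subset_Icc_self ht))).hasDerivWithinAt) θ ⟨hθ0, le_rfl⟩
  rw [← hconst, rotIntegral]
  have hbound : ∀ p : Space3, ‖((2 * energy m p)⁻¹ : ℝ) * rotIntegrand m σ G e u x θ p‖ ≤
      C * 6 ^ N * Real.exp (2 * R * m) * Real.exp (-m * r) * W p := by
    intro p
    have hω0 := energy_nonneg m p
    have hd : r - 17 / 10 * R ≤ rotDecay R e u x θ := by
      rw [hdecay, sub_self, Real.cos_zero, mul_one]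
      have := mul_le_mul_of_nonneg_left (Real.abs_sin_le_one θ) (show 0 ≤ 17 / 10 * R by positivity)
      linarith
    rw [norm_mul, Complex.norm_real, Real.norm_of_nonneg (by positivity)]
    calc _ ≤ (2 * energy m p)⁻¹ * (C * 6 ^ N * ((1 + energy m p) ^ N *
          Real.exp (-rotDecay R e u x θ * energy m p))) := by
          gcongr; exact norm_rotIntegrand_le hb hC hR hσ he.le u x θ p
      _ ≤ (2 * energy m p)⁻¹ * (C * 6 ^ N * ((1 + energy m p) ^ N *
          (Real.exp (2 * R * m) * Real.exp (-m * r) *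
            Real.exp (-(3 / 10 * R) * energy m p)))) := by
          gcongr
          rw [← Real.exp_add, ← Real.exp_add]
          gcongr
          -- The splitting is `(r - 17/10 R) ω = (r - 2R) ω + 3/10 R ω`, with `(r - 2R) ω ≥ (r - 2R)
          -- m`. The loss `2R m` goes into the constant.
          nlinarith [mul_le_mul_of_nonneg_right hd hω0,
            mul_nonneg (sub_nonneg.2 hr) (sub_nonneg.2 (le_energy m p))]
      _ = _ := by rw [hW]; ring
  calc _ ≤ ∫ p, C * 6 ^ N * Real.exp (2 * R * m) * Real.exp (-m * r) * W p :=
        norm_integral_le_of_norm_le (hWi.const_mul _) (.of_forall hbound)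
    _ = _ := by rw [integral_const_mul]; ring

end RotatedIntegral

/-! ### Application to the two integrals of the theorem -/

section OnShell

variable {R : ℝ}

theorem exists_paleyWienerBound_expPair (hR : 0 < R) (f : 𝓓'((⊤ : Opens Spacetime), ℂ)) :
    ∃ (N : ℕ) (C : ℝ) (D : (Spacetime →L[ℝ] ℂ) → (Spacetime →L[ℝ] ℂ) →L[ℂ] ℂ), 0 ≤ C ∧
      (∀ l, HasFDerivAt (expPair f (narrowCutoff hR)) (D l) l) ∧
      PaleyWienerBound R C N (expPair f (narrowCutoff hR)) D := by
  obtain ⟨N, C, D, hC, h⟩ := exists_expPair_bound f (narrowCutoff hR)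
  exact ⟨N, C, D, hC, fun l => (h l).1, fun l s hs => (h l).2 s fun y hy =>
    hs y (norm_le_of_mem_tsupport_narrowCutoff hR hy)⟩

theorem rotForm_zero (m σ : ℝ) (e : Space3) (p : Space3) :
    rotForm m σ e 0 p = waveForm σ e (energy m p) p 0 := by
  simp [rotForm, rotEnergy, rotShift]

theorem fourierD_eq_expPair (hR : 0 < R) (f : 𝓓'((⊤ : Opens Spacetime), ℂ))
    (hf : Distribution.dsupport f ⊆ Metric.closedBall 0 R) (m σ : ℝ) (e : Space3) (p : Space3) :
    fourierD R f (σ * energy m p) p = expPair f (narrowCutoff hR) (rotForm m σ e 0 p) := by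
  rw [rotForm_zero, expPair_waveForm, fourierD_eq_narrow hR f hf]

theorem continuous_fourierD (hR : 0 < R) (f : 𝓓'((⊤ : Opens Spacetime), ℂ))
    (hf : Distribution.dsupport f ⊆ Metric.closedBall 0 R) (m σ : ℝ) :
    Continuous fun p => fourierD R f (σ * energy m p) p := by
  obtain ⟨N, C, D, -, hG, -⟩ := exists_paleyWienerBound_expPair hR f
  have h : Continuous (expPair f (narrowCutoff hR)) :=
    continuous_iff_continuousAt.2 fun l => (hG l).continuousAt
  -- At angle zero the direction is irrelevant, so `e = 0` is allowed.
  simp_rw [fourierD_eq_expPair hR f hf m σ 0]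
  have h1 : Continuous fun p : Space3 => (p, (0 : ℝ)) := by fun_prop
  have h2 := (continuous_rotForm (m := m) (σ := σ) (e := 0)).comp h1
  rw [Function.comp_def] at h2
  exact h.comp h2

theorem exists_norm_fourierD_le (hR : 0 < R) (f : 𝓓'((⊤ : Opens Spacetime), ℂ))
    (hf : Distribution.dsupport f ⊆ Metric.closedBall 0 R) (m : ℝ) {σ : ℝ} (hσ : |σ| = 1) :
    ∃ (C : ℝ) (N : ℕ), ∀ p, ‖fourierD R f (σ * energy m p) p‖ ≤ C * (1 + energy m p) ^ N := by
  obtain ⟨N, C, D, hC, -, hb⟩ := exists_paleyWienerBound_expPair hR f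
  refine ⟨C * 6 ^ N, N, fun p => ?_⟩
  have h := (hb.rotForm_le (m := m) (e := 0) hC hR hσ (by simp) 0 p).1
  rw [fourierD_eq_expPair hR f hf m σ 0]
  simpa using h

theorem shellIntegral_eq_rotIntegral (hR : 0 < R) (f : 𝓓'((⊤ : Opens Spacetime), ℂ))
    (hf : Distribution.dsupport f ⊆ Metric.closedBall 0 R) (m σ : ℝ) (e : Space3) (u : ℝ)
    (x : Space3) :
    shellIntegral m (fun p => fourierD R f (σ * energy m p) p) (-Complex.I * u) x =
      rotIntegral m σ (expPair f (narrowCutoff hR)) e u x 0 := by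
  rw [shellIntegral, rotIntegral]
  congr 1
  ext p
  have h : rotPhase m e u x 0 p = -Complex.I * (-Complex.I * u * (energy m p : ℂ) -
      ((inner ℝ p x : ℝ) : ℂ)) := by
    simp only [rotPhase, rotEnergy, rotShift, Real.cos_zero, Real.sin_zero]
    push_cast
    linear_combination (-(u : ℂ) * (energy m p : ℂ)) * Complex.I_sq
  rw [shellIntegrand, rotIntegrand, fourierD_eq_expPair hR f hf m σ e, h]
  push_cast
  ring

theorem exists_norm_shellIntegral_le (hR : 0 < R) (f : 𝓓'((⊤ : Opens Spacetime), ℂ))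
    (hf : Distribution.dsupport f ⊆ Metric.closedBall 0 R) {m σ : ℝ} (hm : 0 < m)
    (hσ : |σ| = 1) :
    ∃ c : ℝ, 0 ≤ c ∧ ∀ (u : ℝ) (x : Space3), 0 < u → 2 * R ≤ √(u ^ 2 + ‖x‖ ^ 2) →
      ‖shellIntegral m (fun p => fourierD R f (σ * energy m p) p) (-Complex.I * u) x‖ ≤
        c * Real.exp (-m * √(u ^ 2 + ‖x‖ ^ 2)) := by
  obtain ⟨N, C, D, hC, hG, hb⟩ := exists_paleyWienerBound_expPair hR f
  obtain ⟨c, hc, h⟩ := exists_norm_rotIntegral_zero_le hG hb hC hR hσ hm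
  refine ⟨c, hc, fun u x hu hr => ?_⟩
  obtain ⟨e, he⟩ := h u x hu hr
  rwa [shellIntegral_eq_rotIntegral hR f hf m σ e]

theorem onShellIntegrand_eq (m R : ℝ) (f : 𝓓'((⊤ : Opens Spacetime), ℂ)) (z : ℂ)
    (x p : Space3) :
    onShellIntegrand m R f z x p =
      shellIntegrand m (fun p => fourierD R f (1 * energy m p) p) z x p := by
  simp only [one_mul]; rfl

theorem onShellIntegral_eq (m R : ℝ) (f : 𝓓'((⊤ : Opens Spacetime), ℂ)) :
    onShellIntegral m R f = shellIntegral m (fun p => fourierD R f (1 * energy m p) p) := by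
  simp only [one_mul]; rfl

/-- The damping is an imaginary time shift: `exp(-b ω_p)` turns `z` into `z - ib`. Every statement
about `I_f^b` then reduces to one about a mass-shell integral with `σ = -1`. -/
theorem dampedIntegrand_eq (m R : ℝ) (f : 𝓓'((⊤ : Opens Spacetime), ℂ)) (b : ℝ) (z : ℂ)
    (x p : Space3) :
    dampedIntegrand m R f b z x p =
      shellIntegrand m (fun p => fourierD R f (-1 * energy m p) p) (z - b * Complex.I) x p := by
  have h : -Complex.I * ((z - b * Complex.I) * (energy m p : ℂ) - ((inner ℝ p x : ℝ) : ℂ)) =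
      -Complex.I * (z * (energy m p : ℂ) - ((inner ℝ p x : ℝ) : ℂ)) +
        ((-b * energy m p : ℝ) : ℂ) := by
    push_cast
    linear_combination ((b : ℂ) * (energy m p : ℂ)) * Complex.I_sq
  rw [dampedIntegrand, shellIntegrand, h, Complex.exp_add, ← Complex.ofReal_exp, neg_one_mul]
  ring

theorem dampedIntegral_eq (m R : ℝ) (f : 𝓓'((⊤ : Opens Spacetime), ℂ)) (b : ℝ) (z : ℂ)
    (x : Space3) :
    dampedIntegral m R f b z x =
      shellIntegral m (fun p => fourierD R f (-1 * energy m p) p) (z - b * Complex.I) x := by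
  simp only [dampedIntegral, shellIntegral, dampedIntegrand_eq]

theorem oscillatoryIntegrand_eq (m R : ℝ) (f : 𝓓'((⊤ : Opens Spacetime), ℂ))
    (φ : 𝓢(Spacetime, ℂ)) :
    oscillatoryIntegrand m R f φ = fun p =>
      1 / (2 * (energy m p : ℂ)) * fourierD R f (1 * energy m p) p * shellFourier m φ p := by
  simp only [one_mul]; rfl

theorem closure_lowerHalfPlane : closure lowerHalfPlane = {z : ℂ | z.im ≤ 0} :=
  Complex.closure_setOfPred_im_lt 0

variable {m b : ℝ} {F : Space3 → ℂ} {C : ℝ} {N : ℕ}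

theorem analyticOnLower_shellIntegral (hF : Continuous F)
    (hb : ∀ p, ‖F p‖ ≤ C * (1 + energy m p) ^ N) : AnalyticOnLower (shellIntegral m F) :=
  ⟨analyticOnNhd_shellIntegral hF hb, differentiableOn_shellIntegral hF hb⟩

theorem analyticOnLower_shellIntegral_sub (hF : Continuous F)
    (hb : ∀ p, ‖F p‖ ≤ C * (1 + energy m p) ^ N) (hb0 : 0 < b) :
    AnalyticOnLower fun z x => shellIntegral m F (z - b * Complex.I) x := by
  have hmem : ∀ z ∈ lowerHalfPlane, z - b * Complex.I ∈ lowerHalfPlane := by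
    intro z hz
    have hz' : z.im < 0 := hz
    simp only [lowerHalfPlane, mem_ofPred_eq, Complex.sub_im, Complex.im_ofReal_mul, Complex.I_im]
    linarith
  refine ⟨fun q hq => ?_, fun x => ?_⟩
  · have h1 : AnalyticAt ℝ (fun q : ℂ × Space3 => (q.1 - b * Complex.I, q.2)) q :=
      (analyticAt_fst.sub analyticAt_const).prod analyticAt_snd
    have h2 := (analyticOnNhd_shellIntegral hF hb (q.1 - b * Complex.I, q.2)
      ⟨hmem _ hq.1, trivial⟩).comp_of_eq h1 rfl
    rw [Function.comp_def] at h2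
    exact h2
  · exact (differentiableOn_shellIntegral hF hb x).comp
      (differentiable_id.sub_const _).differentiableOn hmem

theorem continuousOn_shellIntegral_sub (hF : Continuous F)
    (hb : ∀ p, ‖F p‖ ≤ C * (1 + energy m p) ^ N) (hb0 : 0 < b) :
    ContinuousOn (fun q : ℂ × Space3 => shellIntegral m F (q.1 - b * Complex.I) q.2)
      (closure lowerHalfPlane ×ˢ univ) := by
  have h : ContinuousOn (fun q : ℂ × Space3 => (q.1 - b * Complex.I, q.2))
      (closure lowerHalfPlane ×ˢ univ) := by fun_prop
  have hmem : MapsTo (fun q : ℂ × Space3 => (q.1 - b * Complex.I, q.2))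
      (closure lowerHalfPlane ×ˢ univ) (lowerHalfPlane ×ˢ univ) := by
    rintro q ⟨hq, -⟩
    rw [closure_lowerHalfPlane] at hq
    have hq' : q.1.im ≤ 0 := hq
    refine ⟨?_, trivial⟩
    simp only [lowerHalfPlane, mem_ofPred_eq, Complex.sub_im, Complex.im_ofReal_mul, Complex.I_im]
    linarith
  have h2 := (analyticOnNhd_shellIntegral hF hb).continuousOn.comp h hmem
  rw [Function.comp_def] at h2
  exact h2

end OnShell

end

/-! ### The theorem -/

theorem mainTheorem11 (R : ℝ) (hR : 0 < R) (f : 𝓓'((⊤ : Opens Spacetime), ℂ))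
    (hf : Distribution.dsupport f ⊆ Metric.closedBall 0 R) :
    -- analytic continuation of `I_f`, with its real-time boundary value
    (∀ m : ℝ, 0 ≤ m →
      (∀ z ∈ lowerHalfPlane, ∀ x, Integrable (onShellIntegrand m R f z x)) ∧
      AnalyticOnLower (onShellIntegral m R f) ∧
      ∀ φ : 𝓢(Spacetime, ℂ),
        Integrable (oscillatoryIntegrand m R f φ) ∧
        (∀ ε : ℝ, 0 < ε → Integrable fun y : Spacetime =>
          onShellIntegral m R f ((y 0 : ℂ) - ε * Complex.I) (spatial y) * φ y) ∧
        Tendsto (fun ε : ℝ => ∫ y : Spacetime,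
            onShellIntegral m R f ((y 0 : ℂ) - ε * Complex.I) (spatial y) * φ y)
          (𝓝[>] 0) (𝓝 (∫ p : Space3, oscillatoryIntegrand m R f φ p))) ∧
    -- analytic continuation of `I_f^b`, which is a continuous function at real times
    (∀ m : ℝ, 0 ≤ m → ∀ b : ℝ, 0 < b →
      (∀ z ∈ closure lowerHalfPlane, ∀ x, Integrable (dampedIntegrand m R f b z x)) ∧
      AnalyticOnLower (dampedIntegral m R f b) ∧
      ContinuousOn (fun q : ℂ × Space3 => dampedIntegral m R f b q.1 q.2)
        (closure lowerHalfPlane ×ˢ univ)) ∧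
    -- exponential decay
    ∀ m : ℝ, 0 < m → ∃ c : ℝ, ∀ (u : ℝ) (x : Space3), 0 < u →
      2 * R ≤ √(u ^ 2 + ‖x‖ ^ 2) →
        ‖onShellIntegral m R f (-Complex.I * u) x‖ ≤ c * Real.exp (-m * √(u ^ 2 + ‖x‖ ^ 2)) ∧
        ∀ b : ℝ, 0 < b →
          ‖dampedIntegral m R f b (-Complex.I * u) x‖ ≤
            c * Real.exp (-m * √(u ^ 2 + ‖x‖ ^ 2)) := by
  refine ⟨fun m _ => ?_, fun m _ b hb => ?_, fun m hm => ?_⟩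
  · have hF := continuous_fourierD hR f hf m 1
    obtain ⟨C, N, hC⟩ := exists_norm_fourierD_le hR f hf m (σ := 1) (by simp)
    refine ⟨fun z hz x => ?_, ?_, fun φ => ⟨?_, fun ε hε => ?_, ?_⟩⟩
    · simp only [funext (onShellIntegrand_eq m R f z x)]
      exact integrable_shellIntegrand hF hC hz x
    · rw [onShellIntegral_eq]
      exact analyticOnLower_shellIntegral hF hC
    · rw [oscillatoryIntegrand_eq]
      exact integrable_shellFourier hF hC φ
    · rw [onShellIntegral_eq]
      exact integrable_shellIntegral_mul hF hC φ hε
    · rw [onShellIntegral_eq, oscillatoryIntegrand_eq]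
      exact tendsto_integral_shellIntegral_mul hF hC φ
  · have hF := continuous_fourierD hR f hf m (-1)
    obtain ⟨C, N, hC⟩ := exists_norm_fourierD_le hR f hf m (σ := -1) (by simp)
    simp only [funext₂ (dampedIntegral_eq m R f b)]
    refine ⟨fun z hz x => ?_, analyticOnLower_shellIntegral_sub hF hC hb,
      continuousOn_shellIntegral_sub hF hC hb⟩
    simp only [funext (dampedIntegrand_eq m R f b z x)]
    rw [closure_lowerHalfPlane] at hz
    have hz' : z.im ≤ 0 := hz
    refine integrable_shellIntegrand hF hC ?_ x
    simp only [Complex.sub_im, Complex.im_ofReal_mul, Complex.I_im]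
    linarith
  · obtain ⟨c₁, hc₁, h₁⟩ := exists_norm_shellIntegral_le hR f hf hm (σ := 1) (by simp)
    obtain ⟨c₂, hc₂, h₂⟩ := exists_norm_shellIntegral_le hR f hf hm (σ := -1) (by simp)
    refine ⟨max c₁ c₂, fun u x hu hr => ⟨?_, fun b hb => ?_⟩⟩
    · rw [onShellIntegral_eq]
      exact (h₁ u x hu hr).trans (by gcongr; exact le_max_left _ _)
    -- At `z = -iu` the damped integral is the undamped mass-shell integral at `-i(u + b)`. The
    -- radius only grows with `b`, so the constant is uniform in `b`.
    · have hle : √(u ^ 2 + ‖x‖ ^ 2) ≤ √((u + b) ^ 2 + ‖x‖ ^ 2) := by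
        gcongr; linarith
      have h := h₂ (u + b) x (by linarith) (hr.trans hle)
      rw [dampedIntegral_eq]
      have harg : -Complex.I * u - b * Complex.I = -Complex.I * ((u + b : ℝ) : ℂ) := by
        push_cast; ring
      rw [harg]
      refine h.trans ?_
      have hexp : -m * √((u + b) ^ 2 + ‖x‖ ^ 2) ≤ -m * √(u ^ 2 + ‖x‖ ^ 2) := by
        nlinarith
      exact mul_le_mul (le_max_right _ _) (Real.exp_le_exp.2 hexp) (Real.exp_pos _).le
        (hc₂.trans (le_max_right _ _))
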